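/- Theorem 1.2. For finite graphs $G,H$ and an integer $k\ge 1$, let $gr_k(G:H)$ be the minimum integer $n$ such that every colouring of the edges of the complete graph $K_n$ with colours from $\{1,\dots,k\}$ (not all of which need be used) contains a rainbow copy of $G$ (all edges of the copy have different colours) or a monochromatic copy of $H$ (all edges of the copy have the same colour). Copies are not required to be induced. Let $F_9$ be the bull, i.e. the graph on five vertices consisting of a triangle with one pendant edge attached at each of two different vertices of the triangle, and let $F_{10}$ be the house, i.e. the graph on five vertices with six edges consisting of a triangle and a $4$-cycle that share exactly one edge. Then for every integer $k\ge 1$, $$gr_k(K_3:F_9)=gr_k(K_3:F_{10})=\begin{cases}8\cdot 5^{(k-2)/2}+1 & \text{if } k \text{ is even},\\ 4\cdot 5^{(k-1)/2}+1 & \text{if } k \text{ is odd}.\end{cases}$$ -/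

import Mathlib

/-- An edge-labelling `c` of the complete graph on `V` contains a rainbow copy of `G`: there is a
(not necessarily induced) copy of `G` in the complete graph whose edges receive pairwise distinct
labels. -/
def HasRainbowCopy {V K W : Type*} (c : SimpleGraph.TopEdgeLabeling V K) (G : SimpleGraph W) :
    Prop :=
  ∃ f : SimpleGraph.Copy G (⊤ : SimpleGraph V),
    Function.Injective fun e : G.edgeSet => c (f.mapEdgeSet e)

/-- An edge-labelling `c` of the complete graph on `V` contains a monochromatic copy of `H`: there
is a (not necessarily induced) copy of `H` in the complete graph all of whose edges receive the
same label. -/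
def HasMonochromaticCopy {V K W : Type*} (c : SimpleGraph.TopEdgeLabeling V K)
    (H : SimpleGraph W) : Prop :=
  ∃ f : SimpleGraph.Copy H (⊤ : SimpleGraph V),
    ∃ i : K, ∀ e : H.edgeSet, c (f.mapEdgeSet e) = i

/-- `n` is the `k`-coloured Gallai-Ramsey number `gr_k(G : H)`: it is the minimum integer such that
every `k`-edge-colouring of the complete graph on `n` vertices (not necessarily using all `k`
colours) contains a rainbow copy of `G` or a monochromatic copy of `H`. -/
def IsGallaiRamseyNumber {W W' : Type*} (k : ℕ) (G : SimpleGraph W) (H : SimpleGraph W')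
    (n : ℕ) : Prop :=
  IsLeast {n : ℕ | ∀ c : SimpleGraph.TopEdgeLabeling (Fin n) (Fin k),
    HasRainbowCopy c G ∨ HasMonochromaticCopy c H} n

/-- The graph `F₉`, the bull: a triangle `0, 1, 2` with pendant edges at two different vertices
of the triangle. -/
def F9 : SimpleGraph (Fin 5) :=
  SimpleGraph.fromEdgeSet {s(0, 1), s(0, 2), s(1, 2), s(0, 3), s(1, 4)}

/-- The graph `F₁₀`, the house: the triangle `0, 1, 2` and the 4-cycle `0, 1, 4, 3`
sharing the edge `0 1`. -/
def F10 : SimpleGraph (Fin 5) :=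
  SimpleGraph.fromEdgeSet {s(0, 1), s(0, 2), s(1, 2), s(0, 3), s(1, 4), s(3, 4)}

/-! Write f(k) for `gallaiBound k`, so that f(1) = 4, f(2) = 8 and f(k+2) = 5 f(k). The bull is a
subgraph of the house, so both numbers follow once K_{f(k)} is coloured without a monochromatic bull
and f(k) + 1 vertices are shown to force a house.

Lower bound: `HasBullFreeColoring.prod` substitutes a colouring into the vertices of another one
that uses new colours and has no monochromatic triangle. Two one-coloured K_4 give f(2), and the
pentagon colouring of K_5 multiplies the order by 5 at the cost of two colours.

Upper bound: K_{2,3} with an edge added in the 3-side contains a house, so in general two sets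
joined in one colour lose that colour inside. A lone vertex joined to A in colour i only forbids
paths on four vertices of colour i in A. The induction therefore proves the stronger
`GallaiBounded`: |E| + |J| ≤ f(k), where J consists of colours without such paths.

If E splits into two parts joined in one colour, `card_add_card_le_of_joined` applies. Otherwise
take a Gallai partition with colours r and b; neither is in J. If only r and b occur, |E| ≤ 8 by a
computer search for the two-colour Ramsey bound. If not, the largest class A has at least two
vertices. In the main case its neighbourhoods in r and b both have at least two vertices as well;
then A avoids both colours, so |A| + |J| ≤ f(k-2), and each neighbourhood has at most 2 f(k-2)
vertices, which adds up to 5 f(k-2). -/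

/-! ### Gallai partitions of colourings without rainbow triangles. -/

section GallaiPartition

variable {V κ : Type*}

/-- A symmetric colouring `c` has no rainbow triangle. -/
def RainbowTriangleFree (c : V → V → κ) : Prop :=
  ∀ x y z, x ≠ y → y ≠ z → x ≠ z → c x y = c y z ∨ c y z = c x z ∨ c x y = c x z

/-- In a three-coloured complete graph without rainbow triangles some colour class is not
connected. -/
theorem RainbowTriangleFree.exists_disconnected_color [DecidableEq V] {d : V → V → Fin 3}
    (hs : ∀ x y, d x y = d y x) (hg : RainbowTriangleFree d) (T : Finset V) (hT : 2 ≤ T.card) :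
    ∃ i : Fin 3, ∃ X ⊆ T, X.Nonempty ∧ X ≠ T ∧ ∀ x ∈ X, ∀ y ∈ T \ X, d x y ≠ i := by
  induction T using Finset.induction_on with
  | empty => simp at hT
  | insert v T hv ih =>
    rw [Finset.card_insert_of_notMem hv] at hT
    by_cases h1 : T.card = 1
    · obtain ⟨w, rfl⟩ := Finset.card_eq_one.1 h1
      have hvw : v ≠ w := by simpa using hv
      obtain ⟨i, hi⟩ : ∃ i : Fin 3, d v w ≠ i := (exists_ne (d v w)).imp fun _ h => h.symm
      refine ⟨i, {v}, by simp, by simp, ?_, ?_⟩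
      · intro h
        have : w ∈ ({v} : Finset V) := by rw [h]; simp
        exact hvw (Finset.mem_singleton.1 this).symm
      · intro x hx y hy
        simp only [Finset.mem_singleton, Finset.mem_sdiff, Finset.mem_insert] at hx hy
        obtain rfl := hx
        obtain rfl : y = w := by tauto
        exact hi
    obtain ⟨i, X, hXT, hXne, hXT', hX⟩ := ih (by omega)
    -- From here on every colour connects `insert v T`, although `i` disconnects `T`. The aim is a
    -- rainbow triangle at `v`.
    by_contra! hcon
    -- components of colour `i` inside `T`
    let R : V → V → Prop := fun u u' => u ∈ T ∧ u' ∈ T ∧ d u u' = i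
    have hRs : ∀ u u', Relation.ReflTransGen R u u' → Relation.ReflTransGen R u' u := by
      intro u u' h
      have : Std.Symm R := ⟨fun a b h => ⟨h.2.1, h.1, by rw [hs]; exact h.2.2⟩⟩
      exact Relation.ReflTransGen.stdSymm.symm _ _ h
    have hRT : ∀ u u', u ∈ T → Relation.ReflTransGen R u u' → u' ∈ T := by
      intro u u' hu h
      cases h with
      | refl => exact hu
      | tail _ h => exact h.2.1
    -- In a triangle on an edge `p q` of colour `i` and a vertex `w` of another component, the other
    -- two edges are not of colour `i`, so they agree.
    have hhom : ∀ u u' w, u ∈ T → w ∈ T → Relation.ReflTransGen R u u' →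
        ¬ Relation.ReflTransGen R u w → d u w = d u' w := by
      intro u u' w hu hw h hn
      induction h with
      | refl => rfl
      | @tail p q hp hpq ih =>
        rw [ih]
        have hpw : d p w ≠ i := fun h => hn (hp.tail ⟨hpq.1, hw, h⟩)
        have hqw : d q w ≠ i := fun h => hn ((hp.tail hpq).tail ⟨hpq.2.1, hw, h⟩)
        by_cases hpq' : p = q
        · rw [hpq']
        have hpw' : p ≠ w := by rintro rfl; exact hn hp
        have hqw' : q ≠ w := by rintro rfl; exact hn (hp.tail hpq)
        rcases hg p q w hpq' hqw' hpw' with h | h | h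
        · exact absurd (h.symm.trans hpq.2.2) hqw
        · exact h.symm
        · exact absurd (h.symm.trans hpq.2.2) hpw
    -- the new vertex sends an edge of colour `i` to every component
    have hred : ∀ u ∈ T, ∃ x, Relation.ReflTransGen R u x ∧ d v x = i := by
      intro u hu
      classical
      let D := T.filter (fun x => Relation.ReflTransGen R u x)
      obtain ⟨x, hx, y, hy, hxy⟩ := hcon i D
        ((Finset.filter_subset _ _).trans (Finset.subset_insert _ _))
        ⟨u, by simpa [D, hu] using Relation.ReflTransGen.refl⟩
        (fun h => hv (Finset.filter_subset _ _ (h ▸ Finset.mem_insert_self v T)))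
      simp only [D, Finset.mem_filter, Finset.mem_sdiff, Finset.mem_insert, not_and] at hx hy
      rcases hy.1 with rfl | hyT
      · exact ⟨x, hx.2, by rw [hs]; exact hxy⟩
      · exact absurd (hx.2.tail ⟨hx.1, hyT, hxy⟩) (hy.2 hyT)
    have hvcol : ∀ j, ∃ y ∈ T, d v y = j := by
      intro j
      have hne : T.Nonempty := Finset.card_pos.1 (by omega)
      obtain ⟨t, ht⟩ := hne
      obtain ⟨x, hx, y, hy, hxy⟩ := hcon j {v} (by simp) (by simp) (by
        intro h
        have : t ∈ ({v} : Finset V) := by rw [h]; simp [ht]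
        rw [Finset.mem_singleton] at this
        exact hv (this ▸ ht))
      simp only [Finset.mem_singleton, Finset.mem_sdiff, Finset.mem_insert] at hx hy
      subst hx
      exact ⟨y, by tauto, hxy⟩
    obtain ⟨j, l, hji, hli, hlj⟩ : ∃ j l : Fin 3, j ≠ i ∧ l ≠ i ∧ l ≠ j := by
      have : ∀ i : Fin 3, ∃ j l : Fin 3, j ≠ i ∧ l ≠ i ∧ l ≠ j := by decide
      exact this i
    obtain ⟨y, hyT, hy⟩ := hvcol j
    obtain ⟨w, hwT, hw⟩ := hvcol l
    have hvT : ∀ t ∈ T, v ≠ t := fun t ht h => hv (h ▸ ht)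
    -- all edges leaving the component of `y` have colour `j`
    have hC : ∀ z ∈ T, ¬ Relation.ReflTransGen R y z → ∀ y', Relation.ReflTransGen R y y' →
        d z y' = j := by
      intro z hz hyz y' hyy'
      obtain ⟨x, hzx, hvx⟩ := hred z hz
      have hxT := hRT z x hz hzx
      have hnxy : ¬ Relation.ReflTransGen R y x := fun h => hyz (h.trans (hRs _ _ hzx))
      have hyx : y ≠ x := by rintro rfl; exact hnxy .refl
      have hxy : d x y = j := by
        have h1 : d x y ≠ i := fun h => hnxy (.single ⟨hyT, hxT, by rw [hs]; exact h⟩)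
        rcases hg v x y (hvT x hxT) hyx.symm (hvT y hyT) with h | h | h
        · exact absurd (h.symm.trans hvx) h1
        · exact h.trans hy
        · exact absurd (hy.symm.trans (h.symm.trans hvx)) hji
      have e1 : d z y = j := by
        rw [hhom z x y hz hyT hzx (fun h => hyz (hRs _ _ h)), hxy]
      rw [hs, ← hhom y y' z hyT hz hyy' hyz, hs, e1]
    have key : ∀ x ∈ T, x ≠ w → d v x = i → d x w = j → False := by
      intro x hxT hxw hvx hxwj
      rcases hg v x w (hvT x hxT) hxw (hvT w hwT) with h | h | h
      · exact hji (hxwj.symm.trans (h.symm.trans hvx))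
      · exact hlj (hw.symm.trans (h.symm.trans hxwj))
      · exact hli (hw.symm.trans (h.symm.trans hvx))
    -- In either case some `x` on the other side of the component of `y` from `w` has `d v x = i`
    -- and `d x w = j`, and `v`, `x`, `w` is rainbow.
    by_cases hwC : Relation.ReflTransGen R y w
    · obtain ⟨z, hzT, hz⟩ : ∃ z ∈ T, ¬ Relation.ReflTransGen R y z := by
        by_contra! hall
        have hside : ∀ u u', Relation.ReflTransGen R u u' → (u ∈ X ↔ u' ∈ X) := by
          intro u u' h
          induction h with
          | refl => rfl
          | @tail p q _ hpq ih =>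
            rw [ih]
            constructor
            · intro hp
              by_contra hq
              exact hX p hp q (by simp [hq, hpq.2.1]) hpq.2.2
            · intro hq
              by_contra hp
              exact hX q hq p (by simp [hp, hpq.1]) (by rw [hs]; exact hpq.2.2)
        obtain ⟨x, hx⟩ := hXne
        have hyX : y ∈ X := (hside y x (hall x (hXT hx))).2 hx
        exact hXT' (Finset.Subset.antisymm hXT fun t ht => (hside y t (hall t ht)).1 hyX)
      obtain ⟨x, hzx, hvx⟩ := hred z hzT
      have hxT := hRT z x hzT hzx
      have hyx : ¬ Relation.ReflTransGen R y x := fun h => hz (h.trans (hRs _ _ hzx))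
      exact key x hxT (by rintro rfl; exact hyx hwC) hvx (hC x hxT hyx w hwC)
    · obtain ⟨x, hyx, hvx⟩ := hred y hyT
      have hxT := hRT y x hyT hyx
      exact key x hxT (by rintro rfl; exact hwC hyx) hvx (by rw [hs]; exact hC w hwT hwC x hyx)

/-- The equivalence `s` partitions the vertices into classes such that all edges between two
different classes have the same colour. -/
def IsHomogeneous (c : V → V → κ) (s : Setoid V) : Prop :=
  ∀ x x' y y', s x x' → s y y' → ¬ s x y → c x' y' = c x y

/-- **Gallai's theorem**: a colouring without rainbow triangles admits a nontrivial homogeneous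
partition such that at most two colours appear between different classes. -/
theorem RainbowTriangleFree.exists_isHomogeneous [Finite V] [Nontrivial V] {c : V → V → κ}
    (hs : ∀ x y, c x y = c y x) (hg : RainbowTriangleFree c) :
    ∃ s : Setoid V, IsHomogeneous c s ∧ s ≠ ⊤ ∧ ∃ r b, ∀ x y, ¬ s x y → c x y = r ∨ c x y = b := by
  classical
  have hbot : IsHomogeneous c ⊥ ∧ (⊥ : Setoid V) ≠ ⊤ := by
    refine ⟨?_, ?_⟩
    · rintro x x' y y' rfl rfl -
      rfl
    · intro h
      obtain ⟨x, y, hxy⟩ := exists_pair_ne V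
      have : (⊤ : Setoid V) x y := trivial
      rw [← h] at this
      exact hxy this
  have : Finite (Setoid V) := Finite.of_injective (fun s : Setoid V => (fun x y => s x y))
    fun s t h => Setoid.ext fun x y => by simpa using congrFun₂ h x y
  -- A maximal proper homogeneous partition works: with a third colour between its classes it could
  -- be coarsened.
  obtain ⟨s, ⟨hsh, hst⟩, hmax⟩ := Set.Finite.exists_maximal
    (Set.toFinite {s : Setoid V | IsHomogeneous c s ∧ s ≠ ⊤}) ⟨⊥, hbot⟩
  refine ⟨s, hsh, hst, ?_⟩
  by_contra! hcon
  obtain ⟨u, v, huv⟩ : ∃ u v, ¬ s u v := by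
    by_contra! h
    exact hst (Setoid.ext fun x y => ⟨fun _ => trivial, fun _ => h x y⟩)
  set c₀ := c u v with hc₀
  obtain ⟨u₁, v₁, huv₁, h10, -⟩ := hcon c₀ c₀
  set c₁ := c u₁ v₁ with hc₁
  obtain ⟨u₂, v₂, huv₂, h20, h21⟩ := hcon c₀ c₁
  -- Merging all colours other than `c₀` and `c₁` makes the three-colour lemma applicable to the
  -- quotient.
  let d : V → V → Fin 3 := fun x y => if c x y = c₀ then 0 else if c x y = c₁ then 1 else 2
  have hds : ∀ x y, d x y = d y x := fun x y => by simp only [d, hs x y]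
  have hdc : ∀ x y x' y', c x y = c x' y' → d x y = d x' y' := by
    intro x y x' y' h
    simp only [d, h]
  have hdg : RainbowTriangleFree d := by
    intro x y z hxy hyz hxz
    rcases hg x y z hxy hyz hxz with h | h | h
    · exact .inl (hdc _ _ _ _ h)
    · exact .inr (.inl (hdc _ _ _ _ h))
    · exact .inr (.inr (hdc _ _ _ _ h))
  have hused : ∀ i : Fin 3, ∃ x y, ¬ s x y ∧ d x y = i := by
    intro i
    fin_cases i
    · exact ⟨u, v, huv, by simp [d, ← hc₀]⟩
    · exact ⟨u₁, v₁, huv₁, by simp [d, ← hc₁, h10]⟩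
    · exact ⟨u₂, v₂, huv₂, by simp [d, h20, h21]⟩
  have hsd : ∀ x y, ¬ s x y → d (⟦x⟧ : Quotient s).out (⟦y⟧ : Quotient s).out = d x y :=
    fun x y h => hdc _ _ _ _ (hsh x _ y _ (s.symm (Quotient.mk_out x)) (s.symm (Quotient.mk_out y)) h)
  let _ : Fintype (Quotient s) := Fintype.ofFinite _
  have hnt : Nontrivial (Quotient s) := ⟨⟦u⟧, ⟦v⟧, fun h => huv (Quotient.exact h)⟩
  obtain ⟨i, X, -, ⟨q, hq⟩, hXT, hX⟩ :=
    RainbowTriangleFree.exists_disconnected_color (d := fun q q' : Quotient s => d q.out q'.out)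
      (fun _ _ => hds _ _)
      (fun x y z hxy hyz hxz => hdg _ _ _ (Quotient.out_injective.ne hxy)
        (Quotient.out_injective.ne hyz) (Quotient.out_injective.ne hxz))
      Finset.univ (by rw [Finset.card_univ]; exact Fintype.one_lt_card)
  simp only [Finset.mem_sdiff, Finset.mem_univ, true_and] at hX
  let R : V → V → Prop := fun x y => s x y ∨ d x y = i
  -- Uniting the classes joined in the disconnected colour `i` gives a strictly coarser partition.
  -- It is proper because `X` is a union of its classes, and homogeneous because vertices joined in
  -- colour `i` look alike from outside.
  let t : Setoid V := Relation.EqvGen.setoid R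
  have htR : ∀ x y, R x y → t x y := fun x y h => Relation.EqvGen.rel x y h
  have hside : ∀ x y, t x y → ((⟦x⟧ : Quotient s) ∈ X ↔ (⟦y⟧ : Quotient s) ∈ X) := by
    intro x y h
    induction h with
    | rel x y h =>
      by_cases hxy : s x y
      · rw [Quotient.sound (s := s) hxy]
      · have hi : d x y = i := h.resolve_left hxy
        rw [← hsd x y hxy] at hi
        constructor
        · intro hx
          by_contra hy
          exact hX _ hx _ hy hi
        · intro hy
          by_contra hx
          exact hX _ hy _ hx (by rw [hds]; exact hi)
    | refl x => rfl
    | symm x y _ ih => exact ih.symm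
    | trans x y z _ _ h1 h2 => exact h1.trans h2
  have htt : t ≠ ⊤ := by
    intro h
    refine hXT (Finset.eq_univ_of_forall fun q' => ?_)
    have h' : t q.out q'.out := by rw [h]; trivial
    simpa using (hside _ _ h').1 (by simpa using hq)
  have hstep : ∀ x x' y, t x x' → ¬ t x y → c x' y = c x y := by
    intro x x' y h
    induction h with
    | rel x x' h =>
      intro hxy
      by_cases hxx : s x x'
      · exact hsh x x' y y hxx (s.refl y) fun h => hxy (htR _ _ (.inl h))
      have hi : d x x' = i := h.resolve_left hxx
      have hxy' : ¬ t x' y := fun h' => hxy (t.trans (htR _ _ h) h')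
      have hne : d x y ≠ i := fun h => hxy (htR _ _ (.inr h))
      have hne' : d x' y ≠ i := fun h => hxy' (htR _ _ (.inr h))
      rcases hg x x' y (fun h => hxx (h ▸ s.refl _)) (fun h => hxy' (h ▸ t.refl _))
        (fun h => hxy (h ▸ t.refl _)) with h | h | h
      · exact absurd ((hdc _ _ _ _ h).symm.trans hi) hne'
      · exact h
      · exact absurd ((hdc _ _ _ _ h).symm.trans hi) hne
    | refl x => intro _; rfl
    | symm x x' h ih =>
      intro hxy
      exact (ih fun h' => hxy (t.trans (t.symm h) h')).symm
    | trans x x' x'' h _ ih1 ih2 =>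
      intro hxy
      rw [ih2 fun h' => hxy (t.trans h h'), ih1 hxy]
  have hth : IsHomogeneous c t := by
    intro x x' y y' hx hy hxy
    rw [hs, hstep y y' x' hy fun h => hxy (t.trans hx (t.symm h)), hs, hstep x x' y hx hxy]
  obtain ⟨x, y, hxy, hi⟩ := hused i
  have hle : s ≤ t := fun x y h => htR x y (.inl h)
  exact hxy (hmax ⟨hth, htt⟩ hle (htR x y (.inr hi)))

/-- Gallai's theorem for a finite set of vertices, in terms of the class `cls x` of a vertex. -/
theorem RainbowTriangleFree.exists_partition [DecidableEq V] {c : V → V → κ}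
    (hs : ∀ x y, c x y = c y x) (hg : RainbowTriangleFree c) (E : Finset V) (hE : 2 ≤ E.card) :
    ∃ (cls : V → Finset V) (r b : κ), (∀ x ∈ E, x ∈ cls x ∧ cls x ⊆ E ∧ cls x ≠ E) ∧
      (∀ x ∈ E, ∀ y ∈ cls x, cls y = cls x) ∧
      ∀ x ∈ E, ∀ y ∈ E, y ∉ cls x → (c x y = r ∨ c x y = b) ∧
        ∀ x' ∈ cls x, ∀ y' ∈ cls y, c x' y' = c x y := by
  classical
  have : Nontrivial E := by
    rw [← Fintype.one_lt_card_iff_nontrivial, Fintype.card_coe]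
    omega
  obtain ⟨s, hsh, hst, r, b, hrb⟩ := RainbowTriangleFree.exists_isHomogeneous
    (c := fun x y : E => c x y) (fun _ _ => hs _ _) (fun x y z hxy hyz hxz =>
      hg x y z (Subtype.coe_injective.ne hxy) (Subtype.coe_injective.ne hyz)
        (Subtype.coe_injective.ne hxz))
  let cls : V → Finset V := fun x => E.filter fun y => ∃ hx hy, s ⟨x, hx⟩ ⟨y, hy⟩
  have hmem : ∀ x y, y ∈ cls x ↔ ∃ (hx : x ∈ E) (hy : y ∈ E), s ⟨x, hx⟩ ⟨y, hy⟩ := by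
    intro x y
    simp only [cls, Finset.mem_filter, and_iff_right_iff_imp]
    rintro ⟨_, hy, _⟩
    exact hy
  refine ⟨cls, r, b, fun x hx => ⟨(hmem x x).2 ⟨hx, hx, s.refl _⟩, Finset.filter_subset _ _, ?_⟩,
    ?_, ?_⟩
  · intro h
    refine hst (Setoid.ext fun y z => ⟨fun _ => trivial, fun _ => ?_⟩)
    obtain ⟨_, _, h1⟩ := (hmem x y).1 (by rw [h]; exact y.2)
    obtain ⟨_, _, h2⟩ := (hmem x z).1 (by rw [h]; exact z.2)
    exact s.trans (s.symm h1) h2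
  · intro x hx y hy
    obtain ⟨_, hyE, h1⟩ := (hmem x y).1 hy
    ext z
    rw [hmem, hmem]
    exact ⟨fun ⟨_, hz, h2⟩ => ⟨hx, hz, s.trans h1 h2⟩,
      fun ⟨_, hz, h2⟩ => ⟨hyE, hz, s.trans (s.symm h1) h2⟩⟩
  · intro x hx y hy hxy
    have hxy' : ¬ s ⟨x, hx⟩ ⟨y, hy⟩ := fun h => hxy ((hmem x y).2 ⟨hx, hy, h⟩)
    refine ⟨hrb _ _ hxy', fun x' hx' y' hy' => ?_⟩
    obtain ⟨_, hx'E, h1⟩ := (hmem x x').1 hx'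
    obtain ⟨_, hy'E, h2⟩ := (hmem y y').1 hy'
    exact hsh ⟨x, hx⟩ ⟨x', hx'E⟩ ⟨y, hy⟩ ⟨y', hy'E⟩ h1 h2 hxy'

end GallaiPartition

/-! ### The two-colour Ramsey bound for the house, by exhaustive search. -/

section RamseyHouse

/-- A symmetric colouring `c` has no monochromatic house. -/
def HouseFree {V κ : Type*} (c : V → V → κ) : Prop :=
  ∀ v w x y z, [v, w, x, y, z].Nodup → ∀ i, c v w = i → c v x = i → c w x = i → c v y = i →
    c w z = i → c y z = i → False

/-- Evaluates `n` before passing it on, which keeps kernel reduction from duplicating work. -/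
def forceNat {α : Type} (n : ℕ) (f : ℕ → α) : α :=
  match n with
  | 0 => f 0
  | m + 1 => f m.succ

theorem forceNat_eq {α : Type} (n : ℕ) (f : ℕ → α) : forceNat n f = f n := by
  cases n <;> rfl

/-- The position of the edge `x y` in the colexicographic order. -/
def edgeIdx (x y : ℕ) : ℕ := if x < y then y * (y - 1) / 2 + x else x * (x - 1) / 2 + y

def edgeBit (x y : ℕ) : ℕ := 2 ^ edgeIdx x y

/-- The edge set, as a bit mask, of the house with triangle `v w x` and 4-cycle `v w z y`. -/
def houseMask (v w x y z : ℕ) : ℕ :=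
  edgeBit v w ||| edgeBit v x ||| edgeBit w x ||| edgeBit v y ||| edgeBit w z ||| edgeBit y z

/-- The houses on the vertices `0, …, b` whose last edge is `a b`, in groups that share the edges
recorded in the first component. -/
def houseGroups (a b : ℕ) : List (ℕ × List ℕ) :=
  (List.range a).flatMap fun x => (List.range b).flatMap fun y =>
    if x = y ∨ y = a then [] else
      [(edgeBit x a + edgeBit x b + edgeBit x y,
        ((List.range b).filter fun z => z != x && z != y && z != a).map fun z =>
          houseMask x a b y z),
       (edgeBit x b + edgeBit x y + edgeBit a y,
        ((List.range b).filter fun z => z != x && z != y && z != a).flatMap fun z =>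
          [houseMask x y z b a, houseMask a y z b x])] ++
      if y < a then
        [(edgeBit b x + edgeBit b y + edgeBit x y,
          ((List.range b).filter fun z => z != x && z != y && z != a).map fun z =>
            houseMask b x y a z),
         (edgeBit b x + edgeBit a x + edgeBit b y,
          ((List.range b).filter fun z => z != x && z != y && z != a).flatMap fun z =>
            [houseMask b x a y z, houseMask b a x y z])]
      else []

/-- The edges of the complete graph on `0, …, n - 1`, each with the houses it completes. -/
def houseTable (n : ℕ) : List (ℕ × List (ℕ × List ℕ)) :=
  (List.range n).flatMap fun b => (List.range b).map fun a => (edgeBit a b, houseGroups a b)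

def isSubmask (m x : ℕ) : Bool := Nat.beq (Nat.land m x) m

def coversHouse (l : List (ℕ × List ℕ)) (x : ℕ) : Bool :=
  l.any fun p => isSubmask p.1 x && p.2.any fun m => isSubmask m x

/-- Backtracking search through the two-colourings with colour classes `r` and `b`, along the edges
listed in the table; edges already in `r` keep their colour. The result is `true` if every branch
runs into a monochromatic house. -/
def houseSearch : List (ℕ × List (ℕ × List ℕ)) → ℕ → ℕ → Bool
  | [], _, _ => false
  | (e, l) :: t, r, b =>
    (forceNat (Nat.lor r e) fun r => coversHouse l r || houseSearch t r b) &&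
    (isSubmask e r || forceNat (Nat.lor b e) fun b => coversHouse l b || houseSearch t r b)

/-- Presetting four edges at vertex `0` is no loss, since some colour occurs at least four times at
each vertex of K_9; it shortens the search. -/
theorem houseSearch_nine :
    houseSearch (houseTable 9) (edgeBit 0 1 ||| edgeBit 0 2 ||| edgeBit 0 3 ||| edgeBit 0 4) 0 =
      true := by
  decide +kernel

theorem edgeIdx_inj : ∀ x < 9, ∀ y < 9, ∀ a < 9, ∀ b < 9, x ≠ y → a ≠ b →
    edgeIdx x y = edgeIdx a b → (x = a ∧ y = b) ∨ (x = b ∧ y = a) := by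
  have h : ∀ x y a b : Fin 9, x ≠ y → a ≠ b → edgeIdx x y = edgeIdx a b →
      (x = a ∧ y = b) ∨ (x = b ∧ y = a) := by
    decide +kernel
  intro x hx y hy a ha b hb hxy hab hi
  simpa using h ⟨x, hx⟩ ⟨y, hy⟩ ⟨a, ha⟩ ⟨b, hb⟩ (by simpa using hxy) (by simpa using hab) hi

theorem edgeBit_testBit (x y i : ℕ) : (edgeBit x y).testBit i = decide (edgeIdx x y = i) := by
  simp [edgeBit, Nat.testBit_two_pow]

theorem isSubmask_iff {m x : ℕ} :
    isSubmask m x = true ↔ ∀ i, m.testBit i = true → x.testBit i = true := by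
  have : isSubmask m x = true ↔ m &&& x = m := by
    simp only [isSubmask, Nat.beq_eq]
    rfl
  rw [this, Nat.eq_iff_testBit_eq]
  simp only [Nat.testBit_and]
  refine forall_congr' fun i => ?_
  cases m.testBit i <;> simp

/-- All edges in the mask `r` have colour `u`. -/
def MaskColored (g : ℕ → ℕ → Bool) (u : Bool) (r : ℕ) : Prop :=
  ∀ x < 9, ∀ y < 9, x ≠ y → r.testBit (edgeIdx x y) = true → g x y = u

theorem MaskColored.zero (g : ℕ → ℕ → Bool) (u : Bool) : MaskColored g u 0 := by
  intro x _ y _ _ h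
  simp at h

theorem MaskColored.lor {g : ℕ → ℕ → Bool} (hg : ∀ x y, g x y = g y x) {u : Bool} {r a b : ℕ}
    (h : MaskColored g u r) (ha : a < 9) (hb : b < 9) (hab : a ≠ b) (hu : g a b = u) :
    MaskColored g u (r ||| edgeBit a b) := by
  intro x hx y hy hxy hr
  rw [Nat.testBit_or, Bool.or_eq_true, edgeBit_testBit, decide_eq_true_eq] at hr
  rcases hr with hr | hr
  · exact h x hx y hy hxy hr
  · rcases edgeIdx_inj a ha b hb x hx y hy hab hxy hr with ⟨rfl, rfl⟩ | ⟨rfl, rfl⟩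
    · exact hu
    · rw [hg, hu]

def IsHouseMask (m : ℕ) : Prop :=
  ∃ v < 9, ∃ w < 9, ∃ x < 9, ∃ y < 9, ∃ z < 9, [v, w, x, y, z].Nodup ∧ m = houseMask v w x y z

/-- Soundness needs only that every listed mask is a house. The first components merely speed up the
test, and the list need not be complete. -/
theorem coversHouse_false {g : ℕ → ℕ → Bool}
    (hh : ∀ v < 9, ∀ w < 9, ∀ x < 9, ∀ y < 9, ∀ z < 9, [v, w, x, y, z].Nodup → ∀ u, g v w = u →
      g v x = u → g w x = u → g v y = u → g w z = u → g y z = u → False)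
    {l : List (ℕ × List ℕ)} (hl : ∀ p ∈ l, ∀ m ∈ p.2, IsHouseMask m) {u : Bool} {r : ℕ}
    (hr : MaskColored g u r) : coversHouse l r = false := by
  by_contra h
  simp only [coversHouse, Bool.not_eq_false, List.any_eq_true, Bool.and_eq_true] at h
  obtain ⟨p, hp, -, m, hm, hmr⟩ := h
  obtain ⟨v, hv, w, hw, x, hx, y, hy, z, hz, hnd, rfl⟩ := hl p hp m hm
  rw [isSubmask_iff] at hmr
  have key : ∀ a < 9, ∀ b < 9, a ≠ b →
      (houseMask v w x y z).testBit (edgeIdx a b) = true → g a b = u :=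
    fun a ha b hb hab h => hr a ha b hb hab (hmr _ h)
  have hnd' := hnd
  simp only [List.nodup_cons, List.mem_cons, List.not_mem_nil, or_false, not_or] at hnd'
  obtain ⟨⟨hvw, hvx, hvy, -⟩, ⟨hwx, -, hwz⟩, -, hyz, -⟩ := hnd'
  exact hh v hv w hw x hx y hy z hz hnd u
    (key v hv w hw hvw (by simp [houseMask, edgeBit_testBit]))
    (key v hv x hx hvx (by simp [houseMask, edgeBit_testBit]))
    (key w hw x hx hwx (by simp [houseMask, edgeBit_testBit]))
    (key v hv y hy hvy (by simp [houseMask, edgeBit_testBit]))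
    (key w hw z hz hwz (by simp [houseMask, edgeBit_testBit]))
    (key y hy z hz hyz (by simp [houseMask, edgeBit_testBit]))

/-- Giving each edge its true colour follows a branch that never meets a house, so the search
reaches the end of the table and answers `false`. -/
theorem houseSearch_eq_false {g : ℕ → ℕ → Bool} (hg : ∀ x y, g x y = g y x)
    (hh : ∀ v < 9, ∀ w < 9, ∀ x < 9, ∀ y < 9, ∀ z < 9, [v, w, x, y, z].Nodup → ∀ u, g v w = u →
      g v x = u → g w x = u → g v y = u → g w z = u → g y z = u → False)
    (t : List (ℕ × List (ℕ × List ℕ)))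
    (ht : ∀ p ∈ t, (∃ a < 9, ∃ b < 9, a ≠ b ∧ p.1 = edgeBit a b) ∧
      ∀ q ∈ p.2, ∀ m ∈ q.2, IsHouseMask m) (r b : ℕ) (hr : MaskColored g true r)
    (hb : MaskColored g false b) : houseSearch t r b = false := by
  induction t generalizing r b with
  | nil => rfl
  | cons p t ih =>
    obtain ⟨e, l⟩ := p
    obtain ⟨⟨a₁, ha₁, a₂, ha₂, hne, rfl : e = _⟩, hl⟩ := ht _ List.mem_cons_self
    have ih' := ih fun p hp => ht p (List.mem_cons_of_mem _ hp)
    simp only [houseSearch, forceNat_eq, Bool.and_eq_false_iff, Bool.or_eq_false_iff]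
    rcases hc : g a₁ a₂ with _ | _
    · right
      have hb' := hb.lor hg ha₁ ha₂ hne hc
      refine ⟨?_, coversHouse_false hh hl hb', ih' _ _ hr hb'⟩
      by_contra h
      rw [Bool.not_eq_false, isSubmask_iff] at h
      have := hr a₁ ha₁ a₂ ha₂ hne (h _ (by simp [edgeBit_testBit]))
      simp [hc] at this
    · left
      have hr' := hr.lor hg ha₁ ha₂ hne hc
      exact ⟨coversHouse_false hh hl hr', ih' _ _ hr' hb⟩

theorem isHouseMask_of_mem_houseGroups {a b : ℕ} (hab : a < b) (hb : b < 9) :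
    ∀ p ∈ houseGroups a b, ∀ m ∈ p.2, IsHouseMask m := by
  intro p hp m hm
  have hmk : ∀ v w x y z, v < 9 → w < 9 → x < 9 → y < 9 → z < 9 → [v, w, x, y, z].Nodup →
      IsHouseMask (houseMask v w x y z) := fun v w x y z hv hw hx hy hz h =>
    ⟨v, hv, w, hw, x, hx, y, hy, z, hz, h, rfl⟩
  simp only [houseGroups, List.mem_flatMap, List.mem_range] at hp
  obtain ⟨x, hx, y, hy, hp⟩ := hp
  split_ifs at hp with h1 h2
  · simp at hp
  all_goals
    simp only [List.append_nil, List.cons_append, List.nil_append, List.mem_cons,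
      List.not_mem_nil, or_false] at hp
    rcases hp with rfl | rfl | rfl | rfl
  all_goals
    simp only [List.mem_map, List.mem_flatMap, List.mem_filter, List.mem_range, Bool.and_eq_true,
      bne_iff_ne, List.mem_cons, List.not_mem_nil, or_false] at hm
    obtain ⟨z, hz, hm⟩ := hm
  all_goals first
    | obtain rfl := hm
    | rcases hm with rfl | rfl
  all_goals
    refine hmk _ _ _ _ _ (by omega) (by omega) (by omega) (by omega) (by omega) ?_
    simp only [List.nodup_cons, List.mem_cons, List.not_mem_nil, or_false, not_or,
      not_false_eq_true, List.nodup_nil, and_true]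
    omega

theorem houseTable_spec : ∀ p ∈ houseTable 9, (∃ a < 9, ∃ b < 9, a ≠ b ∧ p.1 = edgeBit a b) ∧
    ∀ q ∈ p.2, ∀ m ∈ q.2, IsHouseMask m := by
  intro p hp
  simp only [houseTable, List.mem_flatMap, List.mem_range, List.mem_map] at hp
  obtain ⟨b, hb, a, hab, rfl⟩ := hp
  exact ⟨⟨a, by omega, b, hb, by omega, rfl⟩, isHouseMask_of_mem_houseGroups hab hb⟩

variable {V κ : Type*} [DecidableEq V] [DecidableEq κ]

theorem HouseFree.card_ne_nine_of_four_le {c : V → V → κ} (hs : ∀ x y, c x y = c y x)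
    (hh : HouseFree c) {r b : κ} {E : Finset V}
    (hE : ∀ x ∈ E, ∀ y ∈ E, x ≠ y → c x y = r ∨ c x y = b) {v : V} (hv : v ∈ E)
    (hdeg : 4 ≤ ((E.erase v).filter fun y => c v y = r).card) : E.card ≠ 9 := by
  intro hcard
  obtain ⟨S, hS, hS4⟩ := Finset.exists_subset_card_eq hdeg
  have hSE : S ⊆ E.erase v := hS.trans (Finset.filter_subset _ _)
  -- Numbering the vertices along `l` makes `v` vertex `0` and four of its `r`-neighbours the
  -- vertices `1` to `4`, as the search presupposes.
  let l : List V := v :: (S.toList ++ ((E.erase v) \ S).toList)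
  have hl : l.Nodup := by
    simp only [l, List.nodup_cons, List.mem_append, Finset.mem_toList, Finset.mem_sdiff,
      List.nodup_append, Finset.nodup_toList]
    refine ⟨fun h => ?_, trivial, trivial, ?_⟩
    · rcases h with h | h
      · exact absurd rfl (Finset.ne_of_mem_erase (hSE h))
      · exact absurd rfl (Finset.ne_of_mem_erase h.1)
    · rintro a ha b hb rfl
      exact hb.2 ha
  have hlen : l.length = 9 := by
    simp only [l, List.length_cons, List.length_append, Finset.length_toList]
    rw [Finset.card_sdiff_of_subset hSE, Finset.card_erase_of_mem hv]
    omega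
  have hlE : ∀ x ∈ l, x ∈ E := by
    intro x hx
    simp only [l, List.mem_cons, List.mem_append, Finset.mem_toList, Finset.mem_sdiff] at hx
    rcases hx with rfl | hx | hx
    · exact hv
    · exact Finset.mem_of_mem_erase (hSE hx)
    · exact Finset.mem_of_mem_erase hx.1
  let f : ℕ → V := fun i => l.getD i v
  have hf : ∀ i (hi : i < 9), f i = l[i] := fun i hi => List.getD_eq_getElem _ _ (by omega)
  have hfE : ∀ i < 9, f i ∈ E := fun i hi => hlE _ (by rw [hf i hi]; exact List.getElem_mem _)
  have hinj : ∀ i < 9, ∀ j < 9, i ≠ j → f i ≠ f j := by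
    intro i hi j hj hij h
    rw [hf i hi, hf j hj] at h
    exact hij (hl.getElem_inj_iff.1 h)
  have hred : ∀ i, 1 ≤ i → i ≤ 4 → c (f 0) (f i) = r := by
    intro i h1 h4
    have hi : f i ∈ S := by
      rw [hf i (by omega)]
      obtain ⟨j, rfl⟩ : ∃ j, i = j + 1 := ⟨i - 1, by omega⟩
      simp only [l, List.getElem_cons_succ]
      rw [List.getElem_append_left (by rw [Finset.length_toList]; omega)]
      exact Finset.mem_toList.1 (List.getElem_mem _)
    exact (Finset.mem_filter.1 (hS hi)).2
  let g : ℕ → ℕ → Bool := fun x y => decide (c (f x) (f y) = r)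
  have hg : ∀ x y, g x y = g y x := fun x y => by simp only [g, hs]
  have hgr : ∀ i, 1 ≤ i → i ≤ 4 → g 0 i = true := fun i h1 h4 => by simp [g, hred i h1 h4]
  have := houseSearch_eq_false hg ?_ (houseTable 9) houseTable_spec
    (edgeBit 0 1 ||| edgeBit 0 2 ||| edgeBit 0 3 ||| edgeBit 0 4) 0 ?_ (.zero _ _)
  · rw [houseSearch_nine] at this
    exact Bool.noConfusion this
  · intro v hv w hw x hx y hy z hz hnd u h1 h2 h3 h4 h5 h6
    have hnd' : [f v, f w, f x, f y, f z].Nodup := by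
      have : ([v, w, x, y, z].map f).Nodup := by
        refine List.Nodup.map_on ?_ hnd
        intro i hi j hj hij
        by_contra hne
        have h9 : ∀ i ∈ [v, w, x, y, z], i < 9 := by simp [hv, hw, hx, hy, hz]
        exact hinj i (h9 i hi) j (h9 j hj) hne hij
      simpa using this
    have hcol : ∀ i < 9, ∀ j < 9, f i ≠ f j → g i j = u → c (f i) (f j) = if u then r else b := by
      intro i hi j hj hij h
      cases u
      · simp [(hE _ (hfE i hi) _ (hfE j hj) hij).resolve_left (by simpa [g] using h)]
      · simpa [g] using h
    simp only [List.nodup_cons, List.mem_cons, List.not_mem_nil, or_false, not_or] at hnd'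
    refine hh (f v) (f w) (f x) (f y) (f z) (by simp; tauto) (if u then r else b) ?_ ?_ ?_ ?_ ?_ ?_
      <;> apply hcol <;> tauto
  · have h0 := MaskColored.lor hg (.zero g true) (by norm_num : 0 < 9) (by norm_num : 1 < 9)
      (by norm_num) (hgr 1 (by norm_num) (by norm_num))
    rw [Nat.zero_or] at h0
    exact ((h0.lor hg (by norm_num) (by norm_num) (by norm_num) (hgr 2 (by norm_num) (by norm_num))).lor
      hg (by norm_num) (by norm_num) (by norm_num) (hgr 3 (by norm_num) (by norm_num))).lor
      hg (by norm_num) (by norm_num) (by norm_num) (hgr 4 (by norm_num) (by norm_num))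

/-- The two-colour Ramsey number of the house is at most `9`. -/
theorem HouseFree.card_le_eight {c : V → V → κ} (hs : ∀ x y, c x y = c y x) (hh : HouseFree c)
    {r b : κ} {E : Finset V}
    (hE : ∀ x ∈ E, ∀ y ∈ E, x ≠ y → c x y = r ∨ c x y = b) : E.card ≤ 8 := by
  by_contra! hcard
  obtain ⟨E', hE', h9⟩ := Finset.exists_subset_card_eq hcard
  have hE9 : ∀ x ∈ E', ∀ y ∈ E', x ≠ y → c x y = r ∨ c x y = b :=
    fun x hx y hy => hE x (hE' hx) y (hE' hy)
  obtain ⟨v, hv⟩ : E'.Nonempty := Finset.card_pos.1 (by omega)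
  -- Of the eight edges at `v` at least four share a colour; the roles of `r` and `b` are
  -- exchangeable.
  by_cases hr : 4 ≤ ((E'.erase v).filter fun y => c v y = r).card
  · exact hh.card_ne_nine_of_four_le hs hE9 hv hr h9
  · refine hh.card_ne_nine_of_four_le hs (fun x hx y hy h => (hE9 x hx y hy h).symm) hv
      ?_ h9
    have h1 := Finset.card_filter_add_card_filter_not (s := E'.erase v) fun y => c v y = r
    rw [Finset.card_erase_of_mem hv] at h1
    have h2 : ((E'.erase v).filter fun y => ¬ c v y = r).card ≤
        ((E'.erase v).filter fun y => c v y = b).card := by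
      refine Finset.card_le_card fun y hy => ?_
      rw [Finset.mem_filter] at hy ⊢
      exact ⟨hy.1, (hE9 v hv y (Finset.mem_of_mem_erase hy.1)
        (Finset.ne_of_mem_erase hy.1).symm).resolve_left hy.2⟩
    omega

end RamseyHouse

/-! ### Upper bound: the extremal function and sets that split. -/

section UpperBound

variable {V κ : Type*} {c : V → V → κ} {E A B : Finset V} {i r b : κ}

/-- The value of `gr_k(K₃ : F₉) - 1`. -/
def gallaiBound (k : ℕ) : ℕ := if Even k then 8 * 5 ^ ((k - 2) / 2) else 4 * 5 ^ ((k - 1) / 2)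

theorem gallaiBound_one : gallaiBound 1 = 4 := by decide

theorem gallaiBound_two : gallaiBound 2 = 8 := by decide

/-- The recursion fails at `k = 0`, where truncated subtraction gives `gallaiBound 0 = gallaiBound 2
= 8`. -/
theorem gallaiBound_add_two {k : ℕ} (hk : 1 ≤ k) : gallaiBound (k + 2) = 5 * gallaiBound k := by
  unfold gallaiBound
  by_cases h : Even k
  · have h2 : Even (k + 2) := by simpa [Nat.even_add] using h
    obtain ⟨m, rfl⟩ := h
    rw [if_pos h2, if_pos (by exact ⟨m, rfl⟩), show (m + m + 2 - 2) / 2 = (m - 1) + 1 by omega,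
      show (m + m - 2) / 2 = m - 1 by omega, pow_succ]
    ring
  · have h2 : ¬ Even (k + 2) := by simpa [Nat.even_add] using h
    rw [if_neg h2, if_neg h]
    obtain ⟨m, rfl⟩ := Nat.not_even_iff_odd.1 h
    rw [show (2 * m + 1 + 2 - 1) / 2 = m + 1 by omega, show (2 * m + 1 - 1) / 2 = m by omega,
      pow_succ]
    ring

/-- The ratios of consecutive values alternate between 2 and 5/2. -/
theorem two_mul_gallaiBound_le {k : ℕ} (hk : 1 ≤ k) : 2 * gallaiBound k ≤ gallaiBound (k + 1) := by
  induction k using Nat.strong_induction_on with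
  | _ k ih =>
    obtain rfl | rfl | ⟨m, hm, rfl⟩ : k = 1 ∨ k = 2 ∨ ∃ m, 1 ≤ m ∧ k = m + 2 := by
      rcases Nat.lt_or_ge 2 k with h | h
      · exact .inr (.inr ⟨k - 2, by omega, by omega⟩)
      · omega
    · decide
    · decide
    · have := ih m (by omega) hm
      rw [gallaiBound_add_two hm, show m + 2 + 1 = (m + 1) + 2 from rfl,
        gallaiBound_add_two (by omega)]
      omega

theorem add_three_le_gallaiBound {k : ℕ} (hk : 1 ≤ k) : k + 3 ≤ gallaiBound k := by
  induction k, hk using Nat.le_induction with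
  | base => decide
  | succ k hk ih =>
    have := two_mul_gallaiBound_le hk
    omega

/-- All edges inside `E` have colours in `K`. -/
def ColoredBy (c : V → V → κ) (E : Finset V) (K : Finset κ) : Prop :=
  ∀ x ∈ E, ∀ y ∈ E, x ≠ y → c x y ∈ K

/-- There is no path on four vertices of colour `i` in `E`. -/
def PathFreeOn (c : V → V → κ) (E : Finset V) (i : κ) : Prop :=
  ∀ w ∈ E, ∀ x ∈ E, ∀ y ∈ E, ∀ z ∈ E, [w, x, y, z].Nodup → c w x = i → c x y = i → c y z = i → False

/-- All edges between `A` and `B` have colour `i`. -/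
def MonoJoined (c : V → V → κ) (A B : Finset V) (i : κ) : Prop :=
  ∀ x ∈ A, ∀ y ∈ B, c x y = i

/-- The edges leaving a nonempty proper subset of `E` never all have the same colour. -/
def NoSplit (c : V → V → κ) [DecidableEq V] (E : Finset V) : Prop :=
  ∀ A ⊆ E, A.Nonempty → A ≠ E → ∀ i, ¬ MonoJoined c A (E \ A) i

/-- The extremal bound for `k` colours: colours in `J`, which are even path-free, contribute
an extra vertex each. -/
def GallaiBounded (c : V → V → κ) (k : ℕ) : Prop :=
  ∀ K : Finset κ, K.card = k → ∀ J ⊆ K, ∀ E : Finset V, ColoredBy c E K →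
    (∀ i ∈ J, PathFreeOn c E i) → E.card + J.card ≤ gallaiBound k

theorem ColoredBy.mono {K : Finset κ} (h : ColoredBy c E K) (hA : A ⊆ E) : ColoredBy c A K :=
  fun x hx y hy => h x (hA hx) y (hA hy)

theorem ColoredBy.erase [DecidableEq κ] {K : Finset κ} (h : ColoredBy c E K)
    (hi : ∀ x ∈ E, ∀ y ∈ E, x ≠ y → c x y ≠ i) : ColoredBy c E (K.erase i) :=
  fun x hx y hy hxy => Finset.mem_erase.2 ⟨hi x hx y hy hxy, h x hx y hy hxy⟩

theorem PathFreeOn.mono (h : PathFreeOn c E i) (hA : A ⊆ E) : PathFreeOn c A i :=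
  fun w hw x hx y hy z hz => h w (hA hw) x (hA hx) y (hA hy) z (hA hz)

theorem MonoJoined.symm (hs : ∀ x y, c x y = c y x) (h : MonoJoined c A B i) : MonoJoined c B A i :=
  fun x hx y hy => by rw [hs]; exact h y hy x hx

variable [DecidableEq V]

/-- An edge `x y` of colour `i` in `A` yields the house with triangle `x b₁ y` and 4-cycle `x b₁ z
b₂`. -/
theorem HouseFree.ne_of_joined (hs : ∀ x y, c x y = c y x) (hh : HouseFree c)
    (hj : MonoJoined c A B i) (hd : Disjoint A B) (hA : 3 ≤ A.card) (hB : 2 ≤ B.card) :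
    ∀ x ∈ A, ∀ y ∈ A, x ≠ y → c x y ≠ i := by
  intro x hx y hy hxy hi
  obtain ⟨b₁, hb₁, b₂, hb₂, hb⟩ := Finset.one_lt_card.1 hB
  obtain ⟨z, hz, hzx⟩ : ∃ z ∈ A, z ∉ ({x, y} : Finset V) :=
    Finset.exists_mem_notMem_of_card_lt_card (lt_of_le_of_lt Finset.card_le_two hA)
  have hne : ∀ a ∈ A, ∀ b ∈ B, a ≠ b := fun a ha b hb' => Finset.disjoint_iff_ne.1 hd a ha b hb'
  have hj' := hj.symm hs
  simp only [Finset.mem_insert, Finset.mem_singleton, not_or] at hzx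
  refine hh x b₁ y b₂ z ?_ i (hj x hx b₁ hb₁) hi (hj' b₁ hb₁ y hy) (hj x hx b₂ hb₂) (hj' b₁ hb₁ z hz)
    (hj' b₂ hb₂ z hz)
  have h1 := hne x hx b₁ hb₁
  have h2 := hne x hx b₂ hb₂
  have h3 := hne y hy b₁ hb₁
  have h4 := hne y hy b₂ hb₂
  have h5 := hne z hz b₁ hb₁
  have h6 := hne z hz b₂ hb₂
  simp only [List.nodup_cons, List.mem_cons, List.not_mem_nil, or_false, not_or,
    not_false_eq_true, List.nodup_nil, and_true]
  exact ⟨⟨h1, hxy, h2, Ne.symm hzx.1⟩, ⟨h3.symm, hb, h5.symm⟩, ⟨h4, Ne.symm hzx.2⟩, h6.symm⟩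

omit [DecidableEq V] in
theorem PathFreeOn.not_joined (hs : ∀ x y, c x y = c y x) (hp : PathFreeOn c E i)
    (hj : MonoJoined c A B i) (hd : Disjoint A B) (hAE : A ⊆ E) (hBE : B ⊆ E)
    (hA : 2 ≤ A.card) (hB : 2 ≤ B.card) : False := by
  obtain ⟨a₁, ha₁, a₂, ha₂, ha⟩ := Finset.one_lt_card.1 hA
  obtain ⟨b₁, hb₁, b₂, hb₂, hb⟩ := Finset.one_lt_card.1 hB
  have hne : ∀ a ∈ A, ∀ b ∈ B, a ≠ b := fun a ha b hb' => Finset.disjoint_iff_ne.1 hd a ha b hb'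
  have hj' := hj.symm hs
  refine hp a₁ (hAE ha₁) b₁ (hBE hb₁) a₂ (hAE ha₂) b₂ (hBE hb₂) ?_ (hj _ ha₁ _ hb₁)
    (hj' _ hb₁ _ ha₂) (hj _ ha₂ _ hb₂)
  have h1 := hne a₁ ha₁ b₁ hb₁
  have h2 := hne a₁ ha₁ b₂ hb₂
  have h3 := hne a₂ ha₂ b₁ hb₁
  have h4 := hne a₂ ha₂ b₂ hb₂
  simp only [List.nodup_cons, List.mem_cons, List.not_mem_nil, or_false, not_or,
    not_false_eq_true, List.nodup_nil, and_true]
  exact ⟨⟨h1, ha, h2⟩, ⟨h3.symm, hb⟩, h4⟩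

omit [DecidableEq V] in
/-- Five vertices spanning a monochromatic clique contain a house. -/
theorem HouseFree.card_le_four_of_clique (hh : HouseFree c)
    (hE : ∀ x ∈ E, ∀ y ∈ E, x ≠ y → c x y = i) : E.card ≤ 4 := by
  by_contra! h
  obtain ⟨S, hS, h5⟩ := Finset.exists_subset_card_eq (show 5 ≤ E.card from h)
  have hl : S.toList.length = 5 := by rw [Finset.length_toList, h5]
  have hnd := S.nodup_toList
  have hmem : ∀ x ∈ S.toList, x ∈ E := fun x hx => hS (Finset.mem_toList.1 hx)
  match hL : S.toList with
  | [] | [_] | [_, _] | [_, _, _] | [_, _, _, _] | _ :: _ :: _ :: _ :: _ :: _ :: _ =>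
    rw [hL] at hl; simp at hl
  | [v, w, x, y, z] =>
    rw [hL] at hnd hmem
    have hnd' := hnd
    simp only [List.nodup_cons, List.mem_cons, List.not_mem_nil, or_false, not_or,
      not_false_eq_true, List.nodup_nil, and_true] at hnd'
    simp only [List.mem_cons, List.not_mem_nil, or_false, forall_eq_or_imp, forall_eq] at hmem
    obtain ⟨hv, hw, hx, hy, hz⟩ := hmem
    obtain ⟨⟨h1, h2, h3, h4⟩, ⟨h5, h6, h7⟩, ⟨h8, h9⟩, h10⟩ := hnd'
    exact hh v w x y z hnd i (hE v hv w hw h1) (hE v hv x hx h2) (hE w hw x hx h5)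
      (hE v hv y hy h3) (hE w hw z hz h7) (hE y hy z hz h10)

theorem PathFreeOn.card_le_three_of_clique (hp : PathFreeOn c E i)
    (hE : ∀ x ∈ E, ∀ y ∈ E, x ≠ y → c x y = i) : E.card ≤ 3 := by
  by_contra! h
  obtain ⟨S, hS, h4⟩ := Finset.exists_subset_card_eq (show 4 ≤ E.card from h)
  obtain ⟨T, hT, h2⟩ := Finset.exists_subset_card_eq (show 2 ≤ S.card by omega)
  have hst := Finset.card_sdiff_of_subset hT
  obtain ⟨w, x, hwx, rfl⟩ := Finset.card_eq_two.1 h2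
  obtain ⟨y, z, hyz, hyz'⟩ := Finset.card_eq_two.1 (show (S \ {w, x}).card = 2 by omega)
  have hy : y ∈ S \ {w, x} := by rw [hyz']; simp
  have hz : z ∈ S \ {w, x} := by rw [hyz']; simp
  simp only [Finset.mem_sdiff, Finset.mem_insert, Finset.mem_singleton, not_or] at hy hz
  have hwE : w ∈ E := hS (hT (by simp))
  have hxE : x ∈ E := hS (hT (by simp))
  refine hp w hwE x hxE y (hS hy.1) z (hS hz.1) ?_ (hE _ hwE _ hxE hwx)
    (hE _ hxE _ (hS hy.1) (Ne.symm hy.2.2)) (hE _ (hS hy.1) _ (hS hz.1) hyz)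
  simp only [List.nodup_cons, List.mem_cons, List.not_mem_nil, or_false, not_or,
    not_false_eq_true, List.nodup_nil, and_true]
  exact ⟨⟨hwx, Ne.symm hy.2.1, Ne.symm hz.2.1⟩, ⟨Ne.symm hy.2.2, Ne.symm hz.2.2⟩, hyz⟩

theorem HouseFree.gallaiBounded_one (hh : HouseFree c) : GallaiBounded c 1 := by
  intro K hK J hJ E hE hp
  rw [gallaiBound_one]
  obtain ⟨i, rfl⟩ := Finset.card_eq_one.1 hK
  have hE' : ∀ x ∈ E, ∀ y ∈ E, x ≠ y → c x y = i :=
    fun x hx y hy hxy => Finset.mem_singleton.1 (hE x hx y hy hxy)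
  have h4 := hh.card_le_four_of_clique hE'
  rcases Finset.subset_singleton_iff.1 hJ with rfl | rfl
  · simpa using h4
  · have := (hp i (by simp)).card_le_three_of_clique hE'
    simp only [Finset.card_singleton]
    omega

variable [DecidableEq κ]

omit [DecidableEq V] in
theorem GallaiBounded.erase {k : ℕ} (hb : GallaiBounded c k) {K J : Finset κ}
    (hK : K.card = k + 1) (hi : i ∈ K) (hJ : J ⊆ K) (hE : ColoredBy c E K)
    (hp : ∀ j ∈ J.erase i, PathFreeOn c E j) (hne : ∀ x ∈ E, ∀ y ∈ E, x ≠ y → c x y ≠ i) :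
    E.card + (J.erase i).card ≤ gallaiBound k :=
  hb (K.erase i) (by rw [Finset.card_erase_of_mem hi, hK]; rfl) _ (Finset.erase_subset_erase i hJ) E
    (hE.erase hne) hp

/-- A set that splits into two parts joined in one colour satisfies the bound. -/
theorem card_add_card_le_of_joined (hs : ∀ x y, c x y = c y x) (hh : HouseFree c) {k : ℕ}
    (hk : 1 ≤ k) (hb : GallaiBounded c k) {K J : Finset κ} (hK : K.card = k + 1) (hJ : J ⊆ K)
    (hE : ColoredBy c (A ∪ B) K) (hp : ∀ i ∈ J, PathFreeOn c (A ∪ B) i)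
    (ih : ∀ J ⊆ K, (∀ i ∈ J, PathFreeOn c A i) → A.card + J.card ≤ gallaiBound (k + 1))
    (hd : Disjoint A B) (hB : B.Nonempty) (hj : MonoJoined c A B i) (hAB : B.card ≤ A.card)
    (h5 : 5 ≤ (A ∪ B).card) : (A ∪ B).card + J.card ≤ gallaiBound (k + 1) := by
  rw [Finset.card_union_of_disjoint hd] at h5 ⊢
  have hA3 : 3 ≤ A.card := by omega
  have h2 := two_mul_gallaiBound_le hk
  have h3 := add_three_le_gallaiBound hk
  have hAE : A ⊆ A ∪ B := Finset.subset_union_left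
  have hBE : B ⊆ A ∪ B := Finset.subset_union_right
  have hne : ∀ a ∈ A, ∀ b ∈ B, a ≠ b := fun a ha b hb' => Finset.disjoint_iff_ne.1 hd a ha b hb'
  have hi : i ∈ K := by
    obtain ⟨y, hy⟩ := hB
    obtain ⟨x, hx⟩ := Finset.card_pos.1 (show 0 < A.card by omega)
    rw [← hj x hx y hy]
    exact hE x (hAE hx) y (hBE hy) (hne x hx y hy)
  rcases Nat.lt_or_ge 1 B.card with hB2 | hB1
  · have hiJ : i ∉ J := fun h => (hp i h).not_joined hs hj hd hAE hBE (by omega) hB2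
    have h4 := hb.erase hK hi hJ (hE.mono hAE)
      (fun j hj => (hp j (Finset.mem_of_mem_erase hj)).mono hAE) (hh.ne_of_joined hs hj hd hA3 hB2)
    rw [Finset.erase_eq_of_notMem hiJ] at h4
    have h6 : B.card ≤ gallaiBound k := by
      rcases Nat.lt_or_ge 2 B.card with hB3 | hB3
      · have := hb.erase hK hi (Finset.empty_subset K) (hE.mono hBE) (by simp)
          (hh.ne_of_joined hs (hj.symm hs) hd.symm hB3 (by omega))
        omega
      · omega
    omega
  · obtain ⟨v, rfl⟩ := Finset.card_eq_one.1 (le_antisymm hB1 (Finset.card_pos.2 hB))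
    have hv : ∀ a ∈ A, c a v = i := fun a ha => hj a ha v (by simp)
    have hv' : ∀ a ∈ A, c v a = i := fun a ha => by rw [hs]; exact hv a ha
    have hav : ∀ a ∈ A, a ≠ v := fun a ha => hne a ha v (by simp)
    have hvE : v ∈ A ∪ {v} := hBE (by simp)
    simp only [Finset.card_singleton]
    -- With `i ∈ J`, an edge of colour `i` in `A` would extend through `v` to a forbidden path, so
    -- `A` loses the colour altogether.
    by_cases hiJ : i ∈ J
    · have h4 := hb.erase hK hi hJ (hE.mono hAE)
        (fun j hj => (hp j (Finset.mem_of_mem_erase hj)).mono hAE) (by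
          intro x hx y hy hxy hxyi
          obtain ⟨z, hz, hzx⟩ : ∃ z ∈ A, z ∉ ({x, y} : Finset V) :=
            Finset.exists_mem_notMem_of_card_lt_card (lt_of_le_of_lt Finset.card_le_two hA3)
          simp only [Finset.mem_insert, Finset.mem_singleton, not_or] at hzx
          refine hp i hiJ x (hAE hx) y (hAE hy) v hvE z (hAE hz) ?_ hxyi (hv y hy) (hv' z hz)
          simp only [List.nodup_cons, List.mem_cons, List.not_mem_nil, or_false, not_or,
            not_false_eq_true, List.nodup_nil, and_true]
          exact ⟨⟨hxy, hav x hx, Ne.symm hzx.1⟩, ⟨hav y hy, Ne.symm hzx.2⟩, (hav z hz).symm⟩)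
      rw [Finset.card_erase_of_mem hiJ] at h4
      omega
    -- A path `w x y z` of colour `i` in `A` would give the house with triangle `v x w` and 4-cycle
    -- `v x y z`. So `i` may join `J`, which pays exactly for the vertex `v`.
    · have h4 := ih (insert i J) (Finset.insert_subset hi hJ) (by
        intro j hj
        rcases Finset.mem_insert.1 hj with rfl | hj
        · intro w hw x hx y hy z hz hnd h1 h2 h3
          refine hh v x w z y ?_ j (hv' x hx) (hv' w hw) (by rw [hs]; exact h1) (hv' z hz) h2
            (by rw [hs]; exact h3)
          have e1 := hav w hw
          have e2 := hav x hx
          have e3 := hav y hy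
          have e4 := hav z hz
          simp only [List.nodup_cons, List.mem_cons, List.not_mem_nil, or_false, not_or,
            not_false_eq_true, List.nodup_nil, and_true] at hnd ⊢
          obtain ⟨⟨f1, f2, f3⟩, ⟨f4, f5⟩, f6⟩ := hnd
          exact ⟨⟨e2.symm, e1.symm, e4.symm, e3.symm⟩, ⟨Ne.symm f1, f5, f4⟩, ⟨f3, f2⟩, Ne.symm f6⟩
        · exact (hp j hj).mono hAE)
      rw [Finset.card_insert_of_notMem hiJ] at h4
      omega

end UpperBound

/-! ### Upper bound: sets without splits. -/

section UpperBound

variable {V κ : Type*} {c : V → V → κ} {E A B : Finset V} {r b : κ} {cls : V → Finset V}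
  [DecidableEq V]

/-- `cls x` is the class of `x` in a nontrivial homogeneous partition of `E` such that only the
colours `r` and `b` occur between different classes. -/
structure IsGallaiPartition (c : V → V → κ) (E : Finset V) (cls : V → Finset V) (r b : κ) :
    Prop where
  mem_self : ∀ x ∈ E, x ∈ cls x
  subset : ∀ x ∈ E, cls x ⊆ E
  ne : ∀ x ∈ E, cls x ≠ E
  eq_of_mem : ∀ x ∈ E, ∀ y ∈ cls x, cls y = cls x
  color : ∀ x ∈ E, ∀ y ∈ E, y ∉ cls x → c x y = r ∨ c x y = b
  homogeneous : ∀ x ∈ E, ∀ y ∈ E, y ∉ cls x → ∀ x' ∈ cls x, ∀ y' ∈ cls y, c x' y' = c x y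

namespace IsGallaiPartition

omit [DecidableEq V] in
theorem symm (h : IsGallaiPartition c E cls r b) : IsGallaiPartition c E cls b r :=
  { h with color := fun x hx y hy hxy => (h.color x hx y hy hxy).symm }

omit [DecidableEq V] in
theorem mem_comm (h : IsGallaiPartition c E cls r b) {x y : V} (hx : x ∈ E) (hy : y ∈ E) :
    y ∈ cls x ↔ x ∈ cls y :=
  ⟨fun h' => h.eq_of_mem x hx y h' ▸ h.mem_self x hx,
    fun h' => h.eq_of_mem y hy x h' ▸ h.mem_self y hy⟩

/-- In the absence of splits, both colours of a Gallai partition contain a path on four vertices. -/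
theorem not_pathFreeOn (h : IsGallaiPartition c E cls r b) (hs : ∀ x y, c x y = c y x)
    (hE : NoSplit c E) (h3 : 3 ≤ E.card) : ¬ PathFreeOn c E r := by
  classical
  intro hp
  let N : V → Finset V := fun n => E.filter fun y => y ∉ cls n ∧ c n y = r
  have hN : ∀ n y, y ∈ N n ↔ y ∈ E ∧ y ∉ cls n ∧ c n y = r := fun n y => Finset.mem_filter
  have hNs : ∀ x ∈ E, ∀ y ∈ N x, x ∈ N y := by
    intro x hx y hy
    rw [hN] at hy ⊢
    exact ⟨hx, by rw [← h.mem_comm hx hy.1]; exact hy.2.1, by rw [hs]; exact hy.2.2⟩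
  -- every vertex has a neighbour in colour `r` outside its class
  have hNne : ∀ x ∈ E, (N x).Nonempty := by
    intro x hx
    by_contra hne
    refine hE (cls x) (h.subset x hx) ⟨x, h.mem_self x hx⟩ (h.ne x hx) b fun x' hx' y hy => ?_
    rw [Finset.mem_sdiff] at hy
    rw [h.homogeneous x hx y hy.1 hy.2 x' hx' y (h.mem_self y hy.1)]
    exact (h.color x hx y hy.1 hy.2).resolve_left fun hr => hne ⟨y, (hN x y).2 ⟨hy.1, hy.2, hr⟩⟩
  -- a vertex with two neighbours in colour `r`
  obtain ⟨n, hn, hn2⟩ : ∃ n ∈ E, 2 ≤ (N n).card := by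
    by_contra! hcon
    have huniq : ∀ n ∈ E, ∀ x ∈ N n, ∀ y ∈ N n, x = y := fun n hn x hx y hy =>
      Finset.card_le_one.1 (Nat.le_of_lt_succ (hcon n hn)) x hx y hy
    obtain ⟨x, hx⟩ : E.Nonempty := Finset.card_pos.1 (by omega)
    obtain ⟨y, hy⟩ := hNne x hx
    have hyE := ((hN _ _).1 hy).1
    have hsub : ({x, y} : Finset V) ⊆ E := by
      intro z hz
      rcases Finset.mem_insert.1 hz with rfl | hz
      · exact hx
      · rwa [Finset.mem_singleton.1 hz]
    have aux : ∀ u ∈ E, ∀ w ∈ N u, ∀ z ∈ E, z ≠ u → z ≠ w → c u z = b := by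
      intro u hu w hw z hz hzu hzw
      have hw' := (hN _ _).1 hw
      by_cases hzc : z ∈ cls u
      · refine absurd (huniq w hw'.1 z ?_ u (hNs u hu w hw)) hzu
        refine hNs z hz w ((hN _ _).2 ⟨hw'.1, ?_, ?_⟩)
        · rw [h.eq_of_mem u hu z hzc]
          exact hw'.2.1
        · rw [h.homogeneous u hu w hw'.1 hw'.2.1 z hzc w (h.mem_self w hw'.1), hw'.2.2]
      · exact (h.color u hu z hz hzc).resolve_left fun hr =>
          hzw (huniq u hu z ((hN _ _).2 ⟨hz, hzc, hr⟩) w hw)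
    -- If no vertex has two neighbours in colour `r` outside its class, an `r`-edge `x y` is
    -- isolated and `{x, y}` splits off in colour `b`.
    refine hE {x, y} hsub (by simp) (fun h' => ?_) b fun u hu z hz => ?_
    · have := Finset.card_le_two (a := x) (b := y)
      rw [h'] at this
      omega
    · simp only [Finset.mem_sdiff, Finset.mem_insert, Finset.mem_singleton, not_or] at hu hz
      rcases hu with rfl | rfl
      · exact aux u hx y hy z hz.1 hz.2.1 hz.2.2
      · exact aux u hyE x (hNs x hx u hy) z hz.1 hz.2.2 hz.2.1
  have hsub : cls n ∪ N n ⊆ E := Finset.union_subset (h.subset n hn) (Finset.filter_subset _ _)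
  -- An `r`-edge from `u ∈ N n` to an outside `z` would continue to a path `z u n w`. So `cls n ∪ N
  -- n` splits off in colour `b`, or it is all of `E` and `cls n` splits off in colour `r`.
  refine hE _ hsub ⟨n, Finset.mem_union_left _ (h.mem_self n hn)⟩ (fun h' => ?_) b
    fun u hu z hz => ?_
  · refine hE (cls n) (h.subset n hn) ⟨n, h.mem_self n hn⟩ (h.ne n hn) r fun x hx y hy => ?_
    rw [Finset.mem_sdiff] at hy
    have hyN : y ∈ N n := by
      have : y ∈ cls n ∪ N n := by rw [h']; exact hy.1
      exact (Finset.mem_union.1 this).resolve_left hy.2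
    rw [h.homogeneous n hn y hy.1 hy.2 x hx y (h.mem_self y hy.1)]
    exact ((hN _ _).1 hyN).2.2
  · simp only [Finset.mem_sdiff, Finset.mem_union, not_or] at hz hu
    obtain ⟨hzE, hzc, hzN⟩ := hz
    rcases hu with hu | hu
    · rw [h.homogeneous n hn z hzE hzc u hu z (h.mem_self z hzE)]
      exact (h.color n hn z hzE hzc).resolve_left fun hr => hzN ((hN _ _).2 ⟨hzE, hzc, hr⟩)
    · have hu' := (hN _ _).1 hu
      have hzu : z ∉ cls u := by
        intro hzu
        refine hzN ((hN _ _).2 ⟨hzE, hzc, ?_⟩)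
        rw [h.homogeneous n hn u hu'.1 hu'.2.1 n (h.mem_self n hn) z hzu, hu'.2.2]
      refine (h.color u hu'.1 z hzE hzu).resolve_left fun hr => ?_
      obtain ⟨w, hw, hwu⟩ : ∃ w ∈ N n, w ∉ ({u} : Finset V) :=
        Finset.exists_mem_notMem_of_card_lt_card (by rw [Finset.card_singleton]; exact hn2)
      rw [Finset.mem_singleton] at hwu
      have hw' := (hN _ _).1 hw
      refine hp z hzE u hu'.1 n hn w hw'.1 ?_ (by rw [hs]; exact hr) (by rw [hs]; exact hu'.2.2)
        hw'.2.2
      have e1 : z ≠ u := fun e => hzu (e ▸ h.mem_self u hu'.1)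
      have e2 : z ≠ n := fun e => hzc (e ▸ h.mem_self n hn)
      have e3 : z ≠ w := fun e => hzN (e ▸ hw)
      have e4 : u ≠ n := fun e => hu'.2.1 (e ▸ h.mem_self n hn)
      have e5 : n ≠ w := fun e => hw'.2.1 (by rw [← e]; exact h.mem_self n hn)
      simp only [List.nodup_cons, List.mem_cons, List.not_mem_nil, or_false, not_or,
        not_false_eq_true, List.nodup_nil, and_true]
      exact ⟨⟨e1, e2, e3⟩, ⟨e4, Ne.symm hwu⟩, e5⟩

/-- A union `B` of classes of size at most `F` that is joined in colour `r` to two further vertices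
has size at most `2 * F`. -/
theorem card_le_of_joined (h : IsGallaiPartition c E cls r b) (hs : ∀ x y, c x y = c y x)
    (hh : HouseFree c) {F : ℕ} (hF : 4 ≤ F) (hBE : B ⊆ E) (hd : Disjoint A B)
    (hj : MonoJoined c A B r) (hA : 2 ≤ A.card) (hcls : ∀ y ∈ B, cls y ⊆ B)
    (hclsF : ∀ y ∈ B, (cls y).card ≤ F) : B.card ≤ 2 * F := by
  rcases Nat.lt_or_ge 2 B.card with hB | hB
  swap
  · omega
  have hr := hh.ne_of_joined hs (hj.symm hs) hd.symm hB hA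
  have hb : ∀ x ∈ B, ∀ y ∈ B, y ∉ cls x → c x y = b := by
    intro x hx y hy hxy
    refine (h.color x (hBE hx) y (hBE hy) hxy).resolve_left (hr x hx y hy ?_)
    rintro rfl
    exact hxy (h.mem_self x (hBE hx))
  by_cases hbig : ∃ y ∈ B, 2 ≤ (cls y).card
  · obtain ⟨y, hy, hy2⟩ := hbig
    have hsplit := Finset.card_sdiff_add_card_eq_card (hcls y hy)
    have hyF := hclsF y hy
    suffices (B \ cls y).card ≤ F by omega
    rcases Nat.lt_or_ge 2 (B \ cls y).card with hQ | hQ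
    swap
    · omega
    have hjQ : MonoJoined c (B \ cls y) (cls y) b := by
      intro z hz x hx
      rw [Finset.mem_sdiff] at hz
      rw [hs]
      exact hb x (hcls y hy hx) z hz.1 (by rw [h.eq_of_mem y (hBE hy) x hx]; exact hz.2)
    -- The rest of `B` now avoids `b` as well as `r`, so it lies in a single class.
    have hQb := hh.ne_of_joined hs hjQ Finset.sdiff_disjoint hQ hy2
    obtain ⟨q, hq⟩ : (B \ cls y).Nonempty := Finset.card_pos.1 (by omega)
    have hqB := (Finset.mem_sdiff.1 hq).1
    refine (Finset.card_le_card fun q' hq' => ?_).trans (hclsF q hqB)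
    by_contra hne
    refine hQb q hq q' hq' ?_ (hb q hqB q' (Finset.mem_sdiff.1 hq').1 hne)
    rintro rfl
    exact hne (h.mem_self q (hBE hqB))
  · push Not at hbig
    have : B.card ≤ 4 := hh.card_le_four_of_clique (i := b) fun x hx y hy hxy => by
      refine hb x hx y hy fun hyx => hxy ?_
      exact Finset.card_le_one.1 (Nat.le_of_lt_succ (hbig x hx)) x (h.mem_self x (hBE hx)) y hyx
    omega

/-- Otherwise a class would split off in colour `b`. The witness shows both that `r` occurs and that
`r ≠ b`. -/
theorem exists_color (h : IsGallaiPartition c E cls r b) (hns : NoSplit c E) (hE : E.Nonempty) :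
    ∃ x ∈ E, ∃ y ∈ E, x ≠ y ∧ c x y = r ∧ c x y ≠ b := by
  obtain ⟨x, hx⟩ := hE
  have := hns (cls x) (h.subset x hx) ⟨x, h.mem_self x hx⟩ (h.ne x hx) b
  simp only [MonoJoined, not_forall, Finset.mem_sdiff] at this
  obtain ⟨x', hx', y, hy, hxy⟩ := this
  have hx'E := h.subset x hx hx'
  have hy' : y ∉ cls x' := by rw [h.eq_of_mem x hx x' hx']; exact hy.2
  refine ⟨x', hx'E, y, hy.1, ?_, (h.color x' hx'E y hy.1 hy').resolve_right hxy, hxy⟩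
  rintro rfl
  exact hy' (h.mem_self _ hx'E)

end IsGallaiPartition

variable [DecidableEq κ]

/-- If a class `A` of size at least two has exactly one neighbour in colour `r`, the bound holds. -/
theorem card_add_card_le_of_joined_singleton (hs : ∀ x y, c x y = c y x) (hh : HouseFree c) {k : ℕ}
    (hk : 1 ≤ k) (hb : GallaiBounded c (k + 1)) {K J : Finset κ} (hK : K.card = k + 2) (hJ : J ⊆ K)
    (hrb : r ≠ b) (hrK : r ∈ K) (hbK : b ∈ K) (hrJ : r ∉ J) (hbJ : b ∉ J) {v : V}
    (hE : ColoredBy c (insert v (A ∪ B)) K) (hp : ∀ i ∈ J, PathFreeOn c (insert v (A ∪ B)) i)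
    (hd : Disjoint A B) (hvA : v ∉ A) (hvB : v ∉ B) (hjr : ∀ x ∈ A, c v x = r)
    (hj : MonoJoined c A B b) (hA : 2 ≤ A.card) (hB : 2 ≤ B.card) :
    (insert v (A ∪ B)).card + J.card ≤ gallaiBound (k + 2) := by
  have h2 : _ ≤ gallaiBound (k + 2) := two_mul_gallaiBound_le (show 1 ≤ k + 1 by omega)
  have h3 := add_three_le_gallaiBound (show 1 ≤ k + 1 by omega)
  have hJk : J.card ≤ k := by
    have : J ⊆ (K.erase r).erase b := fun j hj => Finset.mem_erase.2
      ⟨fun e => hbJ (e ▸ hj), Finset.mem_erase.2 ⟨fun e => hrJ (e ▸ hj), hJ hj⟩⟩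
    have := Finset.card_le_card this
    rw [Finset.card_erase_of_mem (Finset.mem_erase.2 ⟨hrb.symm, hbK⟩), Finset.card_erase_of_mem hrK]
      at this
    omega
  have hvE : v ∉ A ∪ B := by simp [hvA, hvB]
  have hAE : A ⊆ insert v (A ∪ B) := Finset.subset_union_left.trans (Finset.subset_insert _ _)
  have hBE : B ⊆ insert v (A ∪ B) := Finset.subset_union_right.trans (Finset.subset_insert _ _)
  have hvAE : insert v A ⊆ insert v (A ∪ B) := Finset.insert_subset_insert _ Finset.subset_union_left
  rw [Finset.card_insert_of_notMem hvE, Finset.card_union_of_disjoint hd]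
  -- The set `insert v A` avoids `b` when `A` has at least three vertices, so `v` costs nothing
  -- extra there. With `B` also bounded by `gallaiBound (k + 1)`, doubling suffices.
  have hA' : A.card + 1 + J.card ≤ gallaiBound (k + 1) := by
    rcases Nat.lt_or_ge 2 A.card with hA3 | hA3
    · have hne := hh.ne_of_joined hs hj hd hA3 hB
      have := hb.erase hK hbK hJ (hE.mono hvAE)
        (fun j hj => (hp j (Finset.mem_of_mem_erase hj)).mono hvAE) (by
          intro x hx y hy hxy
          rcases Finset.mem_insert.1 hx with h₁ | h₁ <;> rcases Finset.mem_insert.1 hy with h₂ | h₂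
          · exact absurd (h₁.trans h₂.symm) hxy
          · rw [h₁, hjr y h₂]; exact hrb
          · rw [h₂, hs, hjr x h₁]; exact hrb
          · exact hne x h₁ y h₂ hxy)
      rwa [Finset.erase_eq_of_notMem hbJ, Finset.card_insert_of_notMem hvA] at this
    · omega
  have hB' : B.card ≤ gallaiBound (k + 1) := by
    rcases Nat.lt_or_ge 2 B.card with hB3 | hB3
    · have := hb.erase hK hbK (Finset.empty_subset K) (hE.mono hBE) (by simp)
          (hh.ne_of_joined hs (hj.symm hs) hd.symm hB3 hA)
      omega
    · omega
  omega

/-- A set without splits satisfies the bound. -/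
theorem IsGallaiPartition.card_add_card_le (h : IsGallaiPartition c E cls r b)
    (hs : ∀ x y, c x y = c y x) (hh : HouseFree c) {k : ℕ} (hk : 1 ≤ k) (hb₀ : GallaiBounded c k)
    (hb₁ : GallaiBounded c (k + 1)) {K J : Finset κ} (hK : K.card = k + 2) (hJ : J ⊆ K)
    (hE : ColoredBy c E K) (hp : ∀ i ∈ J, PathFreeOn c E i) (hns : NoSplit c E)
    (hrb : r ≠ b) (hrK : r ∈ K) (hbK : b ∈ K) (hrJ : r ∉ J) (hbJ : b ∉ J) {x : V} (hx : x ∈ E)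
    (hmax : ∀ y ∈ E, (cls y).card ≤ (cls x).card) (hx2 : 2 ≤ (cls x).card) :
    E.card + J.card ≤ gallaiBound (k + 2) := by
  have h5 := gallaiBound_add_two hk
  have hF := add_three_le_gallaiBound hk
  have hbE : b ∈ K.erase r := Finset.mem_erase.2 ⟨hrb.symm, hbK⟩
  have hrbK : ((K.erase r).erase b).card = k := by
    rw [Finset.card_erase_of_mem hbE, Finset.card_erase_of_mem hrK, hK]; rfl
  have hJrb : J ⊆ (K.erase r).erase b := fun j hj => Finset.mem_erase.2
      ⟨fun e => hbJ (e ▸ hj), Finset.mem_erase.2 ⟨fun e => hrJ (e ▸ hj), hJ hj⟩⟩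
  have hJk := Finset.card_le_card hJrb
  rw [hrbK] at hJk
  set A := cls x with hA
  have hAE : A ⊆ E := h.subset x hx
  set R := (E \ A).filter fun y => c x y = r with hR
  set B := (E \ A).filter fun y => ¬ c x y = r with hB
  have hRE : R ⊆ E := (Finset.filter_subset _ _).trans Finset.sdiff_subset
  have hBE : B ⊆ E := (Finset.filter_subset _ _).trans Finset.sdiff_subset
  have hRm : ∀ y, y ∈ R ↔ (y ∈ E ∧ y ∉ A) ∧ c x y = r := fun y => by
    rw [hR, Finset.mem_filter, Finset.mem_sdiff]
  have hBm : ∀ y, y ∈ B ↔ (y ∈ E ∧ y ∉ A) ∧ ¬ c x y = r := fun y => by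
    rw [hB, Finset.mem_filter, Finset.mem_sdiff]
  have hcard : A.card + (R.card + B.card) = E.card := by
    rw [Finset.card_filter_add_card_filter_not, add_comm]
    exact Finset.card_sdiff_add_card_eq_card hAE
  have hjR : MonoJoined c A R r := by
    intro x' hx' y hy
    rw [hRm] at hy
    rw [h.homogeneous x hx y hy.1.1 hy.1.2 x' hx' y (h.mem_self y hy.1.1), hy.2]
  have hjB : MonoJoined c A B b := by
    intro x' hx' y hy
    rw [hBm] at hy
    rw [h.homogeneous x hx y hy.1.1 hy.1.2 x' hx' y (h.mem_self y hy.1.1)]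
    exact (h.color x hx y hy.1.1 hy.1.2).resolve_left hy.2
  have hdR : Disjoint A R := Finset.disjoint_right.2 fun y hy => ((hRm y).1 hy).1.2
  have hdB : Disjoint A B := Finset.disjoint_right.2 fun y hy => ((hBm y).1 hy).1.2
  have hclsA : ∀ y ∈ E, y ∉ A → ∀ z ∈ cls y, (z ∈ E ∧ z ∉ A) ∧ c x z = c x y := by
    intro y hy hyA z hz
    have hzE := h.subset y hy hz
    refine ⟨⟨hzE, fun hzA => hyA ?_⟩, h.homogeneous x hx y hy hyA x (h.mem_self x hx) z hz⟩
    rw [hA, ← h.eq_of_mem x hx z hzA, h.eq_of_mem y hy z hz]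
    exact h.mem_self y hy
  have hclsR : ∀ y ∈ R, cls y ⊆ R := by
    intro y hy z hz
    rw [hRm] at hy ⊢
    have := hclsA y hy.1.1 hy.1.2 z hz
    exact ⟨this.1, this.2.trans hy.2⟩
  have hclsB : ∀ y ∈ B, cls y ⊆ B := by
    intro y hy z hz
    rw [hBm] at hy ⊢
    have := hclsA y hy.1.1 hy.1.2 z hz
    exact ⟨this.1, by rw [this.2]; exact hy.2⟩
  have hcover : ∀ y ∈ E, y ∉ A → y ∈ R ∨ y ∈ B := by
    intro y hy hyA
    rw [hRm, hBm]
    tauto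
  have hRne : 0 < R.card := by
    rw [Finset.card_pos]
    by_contra hne
    refine hns A hAE ⟨x, h.mem_self x hx⟩ (h.ne x hx) b fun x' hx' y hy => ?_
    rw [Finset.mem_sdiff] at hy
    exact hjB x' hx' y ((hcover y hy.1 hy.2).resolve_left fun h' => hne ⟨y, h'⟩)
  have hBne : 0 < B.card := by
    rw [Finset.card_pos]
    by_contra hne
    refine hns A hAE ⟨x, h.mem_self x hx⟩ (h.ne x hx) r fun x' hx' y hy => ?_
    rw [Finset.mem_sdiff] at hy
    exact hjR x' hx' y ((hcover y hy.1 hy.2).resolve_right fun h' => hne ⟨y, h'⟩)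
  -- the two neighbourhoods of `A` are not both singletons
  have hsingle : ¬ (R.card = 1 ∧ B.card = 1) := by
    rintro ⟨hR1, hB1⟩
    obtain ⟨s, hs'⟩ := Finset.card_eq_one.1 hR1
    obtain ⟨t, ht'⟩ := Finset.card_eq_one.1 hB1
    have hsR : s ∈ R := by rw [hs']; simp
    have htB : t ∈ B := by rw [ht']; simp
    have hsE := ((hRm s).1 hsR).1
    have htE := ((hBm t).1 htB).1
    have hts : t ∉ cls s := by
      intro hts
      exact ((hBm t).1 htB).2 ((hRm t).1 (hclsR s hsR hts)).2
    have hcov : ∀ y ∈ E, y ∈ A ∨ y = s ∨ y = t := by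
      intro y hy
      by_cases hyA : y ∈ A
      · exact .inl hyA
      · have := hcover y hy hyA
        rw [hs', ht', Finset.mem_singleton, Finset.mem_singleton] at this
        exact .inr this
    -- The colour of `s t` decides which of the two vertices is joined to all others in one colour.
    rcases h.color s hsE.1 t htE.1 hts with hst | hst
    · refine hns {s} (by simpa using hsE.1) (by simp)
        (fun e => hsE.2 ?_) r fun s' hs'' y hy => ?_
      · have : x ∈ ({s} : Finset V) := by rw [e]; exact hx
        rw [← Finset.mem_singleton.1 this]
        exact h.mem_self x hx
      · rw [Finset.mem_singleton] at hs''
        subst hs''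
        simp only [Finset.mem_sdiff, Finset.mem_singleton] at hy
        rcases hcov y hy.1 with hyA | rfl | rfl
        · rw [hs]; exact hjR y hyA s' hsR
        · exact absurd rfl hy.2
        · exact hst
    · refine hns {t} (by simpa using htE.1) (by simp)
        (fun e => htE.2 ?_) b fun s' hs'' y hy => ?_
      · have : x ∈ ({t} : Finset V) := by rw [e]; exact hx
        rw [← Finset.mem_singleton.1 this]
        exact h.mem_self x hx
      · rw [Finset.mem_singleton] at hs''
        subst hs''
        simp only [Finset.mem_sdiff, Finset.mem_singleton] at hy
        rcases hcov y hy.1 with hyA | rfl | rfl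
        · rw [hs]; exact hjB y hyA s' htB
        · rw [hs]; exact hst
        · exact absurd rfl hy.2
  by_cases hR1 : R.card = 1
  · obtain ⟨v, hv⟩ := Finset.card_eq_one.1 hR1
    have hvR : v ∈ R := by rw [hv]; simp
    have hEeq : E = insert v (A ∪ B) := by
      ext y
      rw [Finset.mem_insert, Finset.mem_union]
      constructor
      · intro hy
        by_cases hyA : y ∈ A
        · exact .inr (.inl hyA)
        · have := hcover y hy hyA
          rw [hv, Finset.mem_singleton] at this
          tauto
      · rintro (rfl | hy | hy)
        · exact hRE hvR
        · exact hAE hy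
        · exact hBE hy
    rw [hEeq] at hE hp ⊢
    exact card_add_card_le_of_joined_singleton hs hh hk hb₁ hK hJ hrb hrK hbK hrJ hbJ hE hp hdB
      ((hRm v).1 hvR).1.2 (fun hvB => ((hBm v).1 hvB).2 ((hRm v).1 hvR).2)
      (fun y hy => by rw [hs]; exact hjR y hy v hvR) hjB hx2 (by omega)
  by_cases hB1 : B.card = 1
  · obtain ⟨v, hv⟩ := Finset.card_eq_one.1 hB1
    have hvB : v ∈ B := by rw [hv]; simp
    have hEeq : E = insert v (A ∪ R) := by
      ext y
      rw [Finset.mem_insert, Finset.mem_union]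
      constructor
      · intro hy
        by_cases hyA : y ∈ A
        · exact .inr (.inl hyA)
        · have := hcover y hy hyA
          rw [hv, Finset.mem_singleton] at this
          tauto
      · rintro (rfl | hy | hy)
        · exact hBE hvB
        · exact hAE hy
        · exact hRE hy
    rw [hEeq] at hE hp ⊢
    exact card_add_card_le_of_joined_singleton hs hh hk hb₁ hK hJ hrb.symm hbK hrK hbJ hrJ hE hp hdR
      ((hBm v).1 hvB).1.2 (fun hvR => ((hBm v).1 hvB).2 ((hRm v).1 hvR).2)
      (fun y hy => by rw [hs]; exact hjB y hy v hvB) hjR hx2 (by omega)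
  -- Both neighbourhoods now have at least two vertices, so `A` contains neither colour once it has
  -- three vertices.
  have hAF : A.card + J.card ≤ gallaiBound k := by
    rcases Nat.lt_or_ge 2 A.card with hA3 | hA3
    · refine hb₀ _ hrbK J hJrb A (((hE.mono hAE).erase ?_).erase ?_) fun i hi => (hp i hi).mono hAE
      · exact hh.ne_of_joined hs hjR hdR hA3 (by omega)
      · exact hh.ne_of_joined hs hjB hdB hA3 (by omega)
    · omega
  have hR2 := h.card_le_of_joined hs hh (F := gallaiBound k) (by omega) hRE hdR hjR hx2 hclsR
    fun y hy => (hmax y (hRE hy)).trans (by omega)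
  have hB2 := h.symm.card_le_of_joined hs hh (F := gallaiBound k) (by omega) hBE hdB hjB hx2 hclsB
    fun y hy => (hmax y (hBE hy)).trans (by omega)
  omega

/-- The upper bound for colourings without rainbow triangles and monochromatic houses. -/
theorem HouseFree.gallaiBounded (hs : ∀ x y, c x y = c y x) (hg : RainbowTriangleFree c)
    (hh : HouseFree c) {k : ℕ} (hk : 1 ≤ k) : GallaiBounded c k := by
  induction k using Nat.strong_induction_on with
  | _ k ihk =>
  obtain rfl | ⟨k, hk', rfl⟩ : k = 1 ∨ ∃ l, 1 ≤ l ∧ k = l + 1 := by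
    rcases Nat.lt_or_ge 1 k with h | h
    · exact .inr ⟨k - 1, by omega, by omega⟩
    · exact .inl (by omega)
  · exact hh.gallaiBounded_one
  have hbk := ihk k (by omega) hk'
  have h2 := two_mul_gallaiBound_le hk'
  have h3 := add_three_le_gallaiBound hk'
  intro K hK J hJ E
  -- The inner induction on the size of `E` lets `J` vary, because removing a single vertex may
  -- enlarge `J`.
  induction hn : E.card using Nat.strong_induction_on generalizing E J with
  | _ n ih =>
  intro hE hp
  subst hn
  have hJk := Finset.card_le_card hJ
  rw [hK] at hJk
  rcases Nat.lt_or_ge 4 E.card with h5 | h4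
  swap
  · omega
  by_cases hsplit : NoSplit c E
  swap
  · simp only [NoSplit, not_forall, not_not] at hsplit
    obtain ⟨A, hA, hAne, hAE, i, hj⟩ := hsplit
    have hBne : (E \ A).Nonempty := by
      rw [Finset.sdiff_nonempty]
      exact fun h' => hAE (Finset.Subset.antisymm hA h')
    have key : ∀ A B : Finset V, A ∪ B = E → Disjoint A B → B.Nonempty → MonoJoined c A B i →
        B.card ≤ A.card → E.card + J.card ≤ gallaiBound (k + 1) := by
      rintro A B rfl hd hB hj hle
      refine card_add_card_le_of_joined hs hh hk' hbk hK hJ hE hp (fun J' hJ' hp' => ?_) hd hB hj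
        hle h5
      have := Finset.card_pos.2 hB
      exact ih A.card (by rw [Finset.card_union_of_disjoint hd]; omega) J' hJ' A rfl
        (hE.mono Finset.subset_union_left) hp'
    rcases Nat.le_total (E \ A).card A.card with hle | hle
    · exact key A (E \ A) (Finset.union_sdiff_of_subset hA) Finset.disjoint_sdiff hBne hj hle
    · exact key (E \ A) A (Finset.sdiff_union_of_subset hA) Finset.sdiff_disjoint hAne (hj.symm hs) hle
  obtain ⟨cls, r, b, h₁, h₂, h₄⟩ := hg.exists_partition hs E (by omega)
  have h : IsGallaiPartition c E cls r b :=
    ⟨fun x hx => (h₁ x hx).1, fun x hx => (h₁ x hx).2.1, fun x hx => (h₁ x hx).2.2, h₂,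
      fun x hx y hy hxy => (h₄ x hx y hy hxy).1, fun x hx y hy hxy => (h₄ x hx y hy hxy).2⟩
  have hEne : E.Nonempty := Finset.card_pos.1 (by omega)
  obtain ⟨x₁, hx₁, y₁, hy₁, hne₁, hr₁, hrb⟩ := h.exists_color hsplit hEne
  rw [hr₁] at hrb
  have hrK : r ∈ K := hr₁ ▸ hE x₁ hx₁ y₁ hy₁ hne₁
  obtain ⟨x₂, hx₂, y₂, hy₂, hne₂, hb₂, -⟩ := h.symm.exists_color hsplit hEne
  have hbK : b ∈ K := hb₂ ▸ hE x₂ hx₂ y₂ hy₂ hne₂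
  have hrJ : r ∉ J := fun hr => h.not_pathFreeOn hs hsplit (by omega) (hp r hr)
  have hbJ : b ∉ J := fun hb => h.symm.not_pathFreeOn hs hsplit (by omega) (hp b hb)
  have hrbK : {r, b} ⊆ K := Finset.insert_subset hrK (Finset.singleton_subset_iff.2 hbK)
  have hJ2 : J.card + 2 ≤ k + 1 := by
    have : J ⊆ K \ {r, b} := fun j hj => by
      simp only [Finset.mem_sdiff, Finset.mem_insert, Finset.mem_singleton, not_or]
      exact ⟨hJ hj, fun e => hrJ (e ▸ hj), fun e => hbJ (e ▸ hj)⟩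
    have := Finset.card_le_card this
    rw [Finset.card_sdiff_of_subset hrbK, Finset.card_pair hrb] at this
    omega
  by_cases htwo : ∀ x ∈ E, ∀ y ∈ E, x ≠ y → c x y = r ∨ c x y = b
  -- Here `J.card ≤ k - 1`, and 8 + (k - 1) ≤ 2(k + 3) ≤ `gallaiBound (k + 1)`.
  · have := hh.card_le_eight hs htwo
    omega
  obtain ⟨x, hx, hmax⟩ := Finset.exists_max_image E (fun x => (cls x).card) hEne
  have hk1 : k ≠ 1 := by
    rintro rfl
    refine htwo fun x hx y hy hxy => ?_
    have := hE x hx y hy hxy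
    rw [← Finset.eq_of_subset_of_card_le hrbK (by rw [hK, Finset.card_pair hrb])] at this
    simpa using this
  have hx2 : 2 ≤ (cls x).card := by
    by_contra hx1
    refine htwo fun y hy z hz hyz => h.color y hy z hz fun hzy => hyz ?_
    exact Finset.card_le_one.1 ((hmax y hy).trans (by omega)) y (h.mem_self y hy) z hzy
  obtain ⟨l, rfl⟩ : ∃ l, k = l + 1 := ⟨k - 1, by omega⟩
  exact h.card_add_card_le hs hh (by omega) (ihk l (by omega) (by omega)) hbk hK hJ hE hp hsplit
    hrb hrK hbK hrJ hbJ hx hmax hx2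

end UpperBound

/-! ### Lower bound: substitution constructions. -/

section LowerBound

/-- A symmetric colouring `c` has no monochromatic bull. -/
def BullFree {V κ : Type*} (c : V → V → κ) : Prop :=
  ∀ v w x y z, [v, w, x, y, z].Nodup → ∀ i, c v w = i → c v x = i → c w x = i → c v y = i →
    c w z = i → False

/-- There is a symmetric colouring of the complete graph on `X` with colours in `κ` and neither a
rainbow triangle nor a monochromatic bull. -/
def HasBullFreeColoring (X κ : Type*) : Prop :=
  ∃ c : X → X → κ, (∀ x y, c x y = c y x) ∧ RainbowTriangleFree c ∧ BullFree c

/-- Substituting a bull-free colouring for the vertices of a colouring with no rainbow and no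
monochromatic triangles. -/
theorem HasBullFreeColoring.prod {X κ Y L : Type*} (h : HasBullFreeColoring X κ) {o : Y → Y → L}
    (hs : ∀ x y, o x y = o y x) (hg : RainbowTriangleFree o)
    (ht : ∀ x y z, x ≠ y → y ≠ z → x ≠ z → ¬ (o x y = o x z ∧ o x y = o y z)) :
    HasBullFreeColoring (Y × X) (κ ⊕ L) := by
  classical
  obtain ⟨c, hcs, hcg, hcb⟩ := h
  let d : Y × X → Y × X → κ ⊕ L := fun p q =>
    if p.1 = q.1 then .inl (c p.2 q.2) else .inr (o p.1 q.1)
  have hd₁ : ∀ p q : Y × X, p.1 = q.1 → d p q = .inl (c p.2 q.2) := fun p q h => if_pos h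
  have hd₂ : ∀ p q : Y × X, p.1 ≠ q.1 → d p q = .inr (o p.1 q.1) := fun p q h => if_neg h
  have hds : ∀ p q, d p q = d q p := by
    intro p q
    by_cases h : p.1 = q.1
    · rw [hd₁ p q h, hd₁ q p h.symm, hcs]
    · rw [hd₂ p q h, hd₂ q p (Ne.symm h), hs]
  have hinl : ∀ p q i, d p q = .inl i → p.1 = q.1 ∧ c p.2 q.2 = i := by
    intro p q i h
    by_cases hpq : p.1 = q.1
    · rw [hd₁ p q hpq] at h
      exact ⟨hpq, Sum.inl_injective h⟩
    · rw [hd₂ p q hpq] at h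
      cases h
  have hinr : ∀ p q i, d p q = .inr i → p.1 ≠ q.1 ∧ o p.1 q.1 = i := by
    intro p q i h
    by_cases hpq : p.1 = q.1
    · rw [hd₁ p q hpq] at h
      cases h
    · rw [hd₂ p q hpq] at h
      exact ⟨hpq, Sum.inr_injective h⟩
  have hsnd : ∀ p q : Y × X, p.1 = q.1 → p ≠ q → p.2 ≠ q.2 := fun p q h hpq h' =>
    hpq (Prod.ext h h')
  refine ⟨d, hds, ?_, ?_⟩
  · intro p q s hpq hqs hps
    by_cases h₁ : p.1 = q.1
    · by_cases h₂ : q.1 = s.1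
      · have h₃ := h₁.trans h₂
        rw [hd₁ _ _ h₁, hd₁ _ _ h₂, hd₁ _ _ h₃]
        simpa using hcg p.2 q.2 s.2 (hsnd _ _ h₁ hpq) (hsnd _ _ h₂ hqs) (hsnd _ _ h₃ hps)
      · have h₃ : p.1 ≠ s.1 := h₁ ▸ h₂
        rw [hd₂ _ _ h₂, hd₂ _ _ h₃, h₁]
        simp
    · by_cases h₂ : q.1 = s.1
      · have h₃ : p.1 ≠ s.1 := h₂ ▸ h₁
        rw [hd₂ _ _ h₁, hd₂ _ _ h₃, h₂]
        simp
      · by_cases h₃ : p.1 = s.1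
        · rw [hd₂ _ _ h₁, hd₂ _ _ h₂, h₃, hs]
          simp
        · rw [hd₂ _ _ h₁, hd₂ _ _ h₂, hd₂ _ _ h₃]
          simpa using hg p.1 q.1 s.1 h₁ h₂ h₃
  -- In an inner colour the bull is connected and stays in one copy of `X`; in an outer colour its
  -- triangle projects to a monochromatic triangle of `o`.
  · rintro v w x y z hnd (i | i) h₁ h₂ h₃ h₄ h₅
    · obtain ⟨e₁, h₁⟩ := hinl _ _ _ h₁
      obtain ⟨e₂, h₂⟩ := hinl _ _ _ h₂
      obtain ⟨-, h₃⟩ := hinl _ _ _ h₃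
      obtain ⟨e₄, h₄⟩ := hinl _ _ _ h₄
      obtain ⟨e₅, h₅⟩ := hinl _ _ _ h₅
      refine hcb v.2 w.2 x.2 y.2 z.2 ?_ i h₁ h₂ h₃ h₄ h₅
      have : ([v, w, x, y, z].map Prod.snd).Nodup := by
        refine List.Nodup.map_on ?_ hnd
        have hv : ∀ p ∈ [v, w, x, y, z], p.1 = v.1 := by
          simp [← e₁, ← e₂, ← e₄, ← e₅]
        exact fun p hp q hq h => Prod.ext ((hv p hp).trans (hv q hq).symm) h
      simpa using this
    · obtain ⟨e₁, h₁⟩ := hinr _ _ _ h₁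
      obtain ⟨e₂, h₂⟩ := hinr _ _ _ h₂
      obtain ⟨e₃, h₃⟩ := hinr _ _ _ h₃
      exact ht v.1 w.1 x.1 e₁ e₃ e₂ ⟨h₁.trans h₂.symm, h₁.trans h₃.symm⟩

theorem hasBullFreeColoring_fin_four : HasBullFreeColoring (Fin 4) (Fin 1) := by
  refine ⟨fun _ _ => 0, fun _ _ => rfl, fun _ _ _ _ _ _ => .inl rfl, ?_⟩
  intro v w x y z hnd
  have := hnd.length_le_card
  simp at this

theorem exists_bullFreeColoring {k : ℕ} (hk : 1 ≤ k) : ∃ (X κ : Type) (_ : Fintype X)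
    (_ : Fintype κ), Fintype.card X = gallaiBound k ∧ Fintype.card κ = k ∧
      HasBullFreeColoring X κ := by
  induction k using Nat.strong_induction_on with
  | _ k ih =>
    obtain rfl | rfl | ⟨m, hm, rfl⟩ : k = 1 ∨ k = 2 ∨ ∃ m, 1 ≤ m ∧ k = m + 2 := by
      rcases Nat.lt_or_ge 2 k with h | h
      · exact .inr (.inr ⟨k - 2, by omega, by omega⟩)
      · omega
    · exact ⟨Fin 4, Fin 1, inferInstance, inferInstance, by simp [gallaiBound_one], by simp,
        hasBullFreeColoring_fin_four⟩
    · exact ⟨Fin 2 × Fin 4, Fin 1 ⊕ Fin 1, inferInstance, inferInstance, by simp [gallaiBound_two],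
        by simp, hasBullFreeColoring_fin_four.prod (o := fun _ _ => 0) (fun _ _ => rfl)
          (fun _ _ _ _ _ _ => .inl rfl) (by decide)⟩
    · obtain ⟨X, κ, _, _, hX, hκ, h⟩ := ih m (by omega) hm
      exact ⟨Fin 5 × X, κ ⊕ Bool, inferInstance, inferInstance,
        by simp [hX, gallaiBound_add_two hm], by simp [hκ],
        -- Addition is modulo 5: the colour classes are a 5-cycle and its complement, again a
        -- 5-cycle, so neither contains a triangle.
        h.prod (o := fun x y : Fin 5 => decide (y = x + 1 ∨ x = y + 1)) (by decide)
          (by unfold RainbowTriangleFree; decide) (by decide)⟩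

end LowerBound

/-! ### Passage between edge labellings and symmetric functions. -/

section Labelings

open SimpleGraph

variable {V K : Type*}

theorem F9_le_F10 : F9 ≤ F10 := by
  refine SimpleGraph.fromEdgeSet_mono ?_
  intro e he
  simp only [Set.mem_insert_iff, Set.mem_singleton_iff] at he ⊢
  tauto

theorem HasMonochromaticCopy.mono {W : Type*} {G H : SimpleGraph W} (hGH : G ≤ H)
    {c : TopEdgeLabeling V K} (h : HasMonochromaticCopy c H) : HasMonochromaticCopy c G := by
  obtain ⟨f, i, hf⟩ := h
  refine ⟨f.comp (Copy.ofLE G H hGH), i, ?_⟩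
  rintro ⟨e, he⟩
  induction e using Sym2.inductionOn with | _ a b
  exact hf ⟨s(a, b), hGH he⟩

theorem get_copy {W : Type*} {G : SimpleGraph W} (c : TopEdgeLabeling V K)
    (f : Copy G (⊤ : SimpleGraph V)) {a b : W} (h : G.Adj a b) :
    c (f.mapEdgeSet ⟨s(a, b), h⟩) = c.get (f a) (f b) (f.toHom.map_adj h) :=
  rfl

/-- An edge labelling as a function on pairs of vertices, with an arbitrary value on the diagonal. -/
noncomputable def labelFun [Nonempty K] (c : TopEdgeLabeling V K) (x y : V) : K :=
  open Classical in if h : x ≠ y then c.get x y h else Classical.arbitrary K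

theorem labelFun_of_ne [Nonempty K] (c : TopEdgeLabeling V K) {x y : V} (h : x ≠ y) :
    labelFun c x y = c.get x y h :=
  dif_pos h

theorem labelFun_comm [Nonempty K] (c : TopEdgeLabeling V K) (x y : V) :
    labelFun c x y = labelFun c y x := by
  by_cases h : x = y
  · rw [h]
  · rw [labelFun_of_ne c h, labelFun_of_ne c (Ne.symm h), EdgeLabeling.get_comm]

theorem rainbowTriangleFree_labelFun [Nonempty K] {c : TopEdgeLabeling V K}
    (h : ¬ HasRainbowCopy c (completeGraph (Fin 3))) : RainbowTriangleFree (labelFun c) := by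
  intro x y z hxy hyz hxz
  by_contra! hne
  obtain ⟨h1, h2, h3⟩ := hne
  let f : Fin 3 → V := ![x, y, z]
  have hf : Function.Injective f := by
    intro a b
    fin_cases a <;> fin_cases b <;> simp [f, hxy, hyz, hxz, hxy.symm, hyz.symm, hxz.symm]
  let g : Copy (completeGraph (Fin 3)) (⊤ : SimpleGraph V) :=
    ⟨⟨f, fun h => hf.ne h⟩, hf⟩
  refine h ⟨g, ?_⟩
  have hg : ∀ (a b : Fin 3) (hab : a ≠ b),
      c (g.mapEdgeSet ⟨s(a, b), hab⟩) = labelFun c (f a) (f b) :=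
    fun a b hab => (labelFun_of_ne c (hf.ne hab)).symm
  rintro ⟨e, he⟩ ⟨e', he'⟩ hee
  induction e using Sym2.inductionOn with | _ a b
  induction e' using Sym2.inductionOn with | _ a' b'
  have hab : a ≠ b := he
  have hab' : a' ≠ b' := he'
  have := (hg a b hab).symm.trans (hee.trans (hg a' b' hab'))
  rw [Subtype.mk.injEq]
  have c1 := labelFun_comm c y x
  have c2 := labelFun_comm c z y
  have c3 := labelFun_comm c z x
  fin_cases a <;> fin_cases b <;> fin_cases a' <;> fin_cases b' <;>
    simp_all [f, Sym2.eq_swap]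

theorem houseFree_labelFun [Nonempty K] {c : TopEdgeLabeling V K}
    (h : ¬ HasMonochromaticCopy c F10) : HouseFree (labelFun c) := by
  intro v w x y z hnd i h1 h2 h3 h4 h5 h6
  let f : Fin 5 → V := ![v, w, x, y, z]
  have hf : Function.Injective f := by
    have : f = [v, w, x, y, z].get := by
      funext a
      fin_cases a <;> rfl
    rw [this]
    exact List.nodup_iff_injective_get.1 hnd
  let g : Copy F10 (⊤ : SimpleGraph V) := ⟨⟨f, fun h => hf.ne h.ne⟩, hf⟩
  refine h ⟨g, i, ?_⟩
  rintro ⟨e, he⟩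
  induction e using Sym2.inductionOn with | _ a b
  have hab : a ≠ b := ((SimpleGraph.mem_edgeSet _).1 he).ne
  have : c (g.mapEdgeSet ⟨s(a, b), he⟩) = labelFun c (f a) (f b) :=
    (labelFun_of_ne c (hf.ne hab)).symm
  rw [this]
  have h1' := (labelFun_comm c w v).trans h1
  have h2' := (labelFun_comm c x v).trans h2
  have h3' := (labelFun_comm c x w).trans h3
  have h4' := (labelFun_comm c y v).trans h4
  have h5' := (labelFun_comm c z w).trans h5
  have h6' := (labelFun_comm c z y).trans h6
  simp only [F10, SimpleGraph.mem_edgeSet, SimpleGraph.fromEdgeSet_adj, Set.mem_insert_iff,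
    Set.mem_singleton_iff, Sym2.eq_iff] at he
  rcases he.1 with (⟨rfl, rfl⟩ | ⟨rfl, rfl⟩) | (⟨rfl, rfl⟩ | ⟨rfl, rfl⟩) |
    (⟨rfl, rfl⟩ | ⟨rfl, rfl⟩) | (⟨rfl, rfl⟩ | ⟨rfl, rfl⟩) | (⟨rfl, rfl⟩ | ⟨rfl, rfl⟩) |
    (⟨rfl, rfl⟩ | ⟨rfl, rfl⟩) <;> assumption

/-- Every sufficiently large edge labelling contains a rainbow triangle or a monochromatic house. -/
theorem hasRainbowCopy_or_hasMonochromaticCopy {n k : ℕ} (hk : 1 ≤ k) (hn : gallaiBound k < n)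
    (c : TopEdgeLabeling (Fin n) (Fin k)) :
    HasRainbowCopy c (completeGraph (Fin 3)) ∨ HasMonochromaticCopy c F10 := by
  by_contra! h
  have : Nonempty (Fin k) := ⟨⟨0, hk⟩⟩
  have := (houseFree_labelFun h.2).gallaiBounded (labelFun_comm c) (rainbowTriangleFree_labelFun h.1)
    hk Finset.univ (by simp) ∅ (by simp) Finset.univ (fun _ _ _ _ _ => Finset.mem_univ _) (by simp)
  simp at this
  omega

/-- Up to the extremal bound there are labellings without rainbow triangles and monochromatic
bulls. -/
theorem exists_labeling {n k : ℕ} (hk : 1 ≤ k) (hn : n ≤ gallaiBound k) :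
    ∃ c : TopEdgeLabeling (Fin n) (Fin k),
      ¬ HasRainbowCopy c (completeGraph (Fin 3)) ∧ ¬ HasMonochromaticCopy c F9 := by
  obtain ⟨X, κ, _, _, hX, hκ, d, hds, hdg, hdb⟩ := exists_bullFreeColoring hk
  -- Minimality needs a colouring for every smaller `n`, obtained by restriction along an embedding.
  obtain ⟨j⟩ : Nonempty (Fin n ↪ X) := Function.Embedding.nonempty_of_card_le (by simp [hX, hn])
  let e : κ ≃ Fin k := Fintype.equivFinOfCardEq hκ
  let c : TopEdgeLabeling (Fin n) (Fin k) :=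
    EdgeLabeling.mk (fun x y _ => e (d (j x) (j y))) fun x y _ => by rw [hds]
  have hc : ∀ x y h, c.get x y h = e (d (j x) (j y)) := fun x y h => rfl
  refine ⟨c, ?_, ?_⟩
  · rintro ⟨f, hf⟩
    have hne : ∀ a b : Fin 3, a ≠ b → j (f a) ≠ j (f b) := fun a b h =>
      j.injective.ne (f.injective.ne h)
    have h01 : (completeGraph (Fin 3)).Adj 0 1 := by simp
    have h12 : (completeGraph (Fin 3)).Adj 1 2 := by simp
    have h02 : (completeGraph (Fin 3)).Adj 0 2 := by simp
    have key : ∀ {a b a' b' : Fin 3} (h : (completeGraph (Fin 3)).Adj a b)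
        (h' : (completeGraph (Fin 3)).Adj a' b'), d (j (f a)) (j (f b)) = d (j (f a')) (j (f b')) →
        s(a, b) = s(a', b') := fun {a b a' b'} h h' hd => by
      have := hf (a₁ := ⟨s(a, b), h⟩) (a₂ := ⟨s(a', b'), h'⟩) (by
        simp only [get_copy, hc]
        rw [hd])
      exact congrArg Subtype.val this
    rcases hdg _ _ _ (hne 0 1 (by decide)) (hne 1 2 (by decide)) (hne 0 2 (by decide)) with h | h | h
    · exact absurd (key h01 h12 h) (by decide)
    · exact absurd (key h12 h02 h) (by decide)
    · exact absurd (key h01 h02 h) (by decide)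
  · rintro ⟨f, i, hf⟩
    have key : ∀ {a b : Fin 5}, F9.Adj a b → d (j (f a)) (j (f b)) = e.symm i := fun {a b} h => by
      have : e (d (j (f a)) (j (f b))) = i := hf ⟨s(a, b), h⟩
      rw [← this, Equiv.symm_apply_apply]
    refine hdb (j (f 0)) (j (f 1)) (j (f 2)) (j (f 3)) (j (f 4)) ?_ (e.symm i)
      (key ?_) (key ?_) (key ?_) (key ?_) (key ?_)
    · have : (([0, 1, 2, 3, 4] : List (Fin 5)).map fun a => j (f a)).Nodup :=
        List.Nodup.map (j.injective.comp f.injective) (by decide)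
      simpa using this
    all_goals simp [F9]

end Labelings

theorem theorem1p2 (k : ℕ) (hk : 1 ≤ k) :
    IsGallaiRamseyNumber k (SimpleGraph.completeGraph (Fin 3)) F9
        (if Even k then 8 * 5 ^ ((k - 2) / 2) + 1 else 4 * 5 ^ ((k - 1) / 2) + 1) ∧
      IsGallaiRamseyNumber k (SimpleGraph.completeGraph (Fin 3)) F10
        (if Even k then 8 * 5 ^ ((k - 2) / 2) + 1 else 4 * 5 ^ ((k - 1) / 2) + 1) := by
  have hval : (if Even k then 8 * 5 ^ ((k - 2) / 2) + 1 else 4 * 5 ^ ((k - 1) / 2) + 1) =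
      gallaiBound k + 1 := by
    unfold gallaiBound
    split_ifs <;> rfl
  rw [hval]
  have hup := fun c => hasRainbowCopy_or_hasMonochromaticCopy hk (Nat.lt_succ_self (gallaiBound k)) c
  -- A house contains a bull: the upper bound passes from the house to the bull, the lower bound
  -- from the bull to the house.
  refine ⟨⟨fun c => (hup c).imp_right (.mono F9_le_F10), fun n hn => ?_⟩, ⟨hup, fun n hn => ?_⟩⟩
  all_goals
    by_contra! hlt
    obtain ⟨c, hc₁, hc₂⟩ := exists_labeling hk (Nat.lt_succ_iff.1 hlt)
  · exact (hn c).elim hc₁ hc₂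
  · exact (hn c).elim hc₁ fun h => hc₂ (h.mono F9_le_F10)
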